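/- Let $k$ be a field of characteristic $0$, let $n\ge 1$, and let $V$ be a $k$-vector space with basis $x_1,\dots,x_n$ and braiding of diagonal type $c(x_i\otimes x_j)=q_{ij}\,x_j\otimes x_i$, where $q=(q_{ij})\in (k^\times)^{n\times n}$. **Notation.** For $\underline m=(m_1,\dots,m_n)\in\mathbb N_0^n$ let $|\underline m|=\sum_i m_i$, and let $e_1,\dots,e_n$ be the standard basis vectors of $\mathbb N_0^n$. Write $\underline l<\underline m$ if $l_i\le m_i$ for all $i$ and $\underline l\ne\underline m$. For $\underline m\neq 0$ let $\gcd(\underline m)=\gcd(m_1,\dots,m_n)$. Let $\ell_{\underline m}$ be the number of Lyndon words over the ordered alphabet $\{1,\dots,n\}$ in which each letter $i$ occurs exactly $m_i$ times; here a nonempty word $w$ is Lyndon if $w\le v$ lexicographically for every factorization $w=uv$ into nonempty words. For $|\underline m|\ge 2$ let $$N(\underline m)=\gcd\{m_i(m_i-1),\,m_jm_l\mid 1\le i,j,l\le n,\ j<l\},$$ $$Q_{\underline m}=\prod_{i}p_{ii}^{m_i(m_i-1)/N(\underline m)}\prod_{i<j}(p_{ij}p_{ji})^{m_im_j/N(\underline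 m)}\in\mathbb Z[p_{ij}\mid 1\le i,j\le n].$$ With $(r)_a=1+a+\dots+a^{r-1}$, define $P_{\underline m}\in\mathbb Z[p_{ij}\mid 1\le i,j\le n]$ for $|\underline m|\ge 2$ as follows, where $i\ne j$ in (2)–(7): 1. $P_{\underline m}=(m_i)_{p_{ii}}$ if $\underline m=m_ie_i$; 2. $P_{\underline m}=1-p_{jj}^{m_j-1}p_{ij}p_{ji}$ if $\underline m=e_i+m_je_j$, $m_j\ge1$; 3. $P_{\underline m}=1+p_{jj}^{m_j(m_j-1)/2}(-p_{ij}p_{ji})^{m_j}p_{ii}$ if $\underline m=2e_i+m_je_j$, $m_j\ge 1$; 4. $P_{\underline m}=(3)_{p_{ii}^2(p_{ij}p_{ji})^3p_{jj}^2}$ if $\underline m=3e_i+3e_j$; 5. $P_{\underline m}=(1-p_{ii}^2(p_{ij}p_{ji})^4p_{jj}^4)\,(3)_{p_{ii}(p_{ij}p_{ji})^2p_{jj}^2}$ if $\underline m=3e_i+4e_j$; 6. $P_{\underline m}=(1-p_{ii}(p_{ij}p_{ji})^3p_{jj}^5)\,(3)_{p_{ii}^2(p_{ij}p_{ji})^6p_{jj}^{10}}$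 if $\underline m=3e_i+6e_j$; 7. $P_{\underline m}=(1+p_{ii}^3(p_{ij}p_{ji})^4p_{jj}^3)(1+p_{ii}^6(p_{ij}p_{ji})^8p_{jj}^6)$ if $\underline m=4e_i+4e_j$; 8. $P_{\underline m}=1-\prod_i p_{ii}^{m_i(m_i-1)}\prod_{i<j}(p_{ij}p_{ji})^{m_im_j}$ otherwise. (Where these cases overlap the formulas agree.) For a polynomial $f\in\mathbb Z[p_{ij}]$ let $f(q)\in k$ be its value at $p_{ij}=q_{ij}$. For $m\ge2$ let $\mathbb B_m$ be the braid monoid with generators $\sigma_1,\dots,\sigma_{m-1}$, and let $\rho_m:k\mathbb B_m\to\operatorname{End}(V^{\otimes m})$ be the algebra map for which $\rho_m(\sigma_i)$ is $c$ applied to the $i$-th and $(i+1)$-th tensor factors. Let $$S_{1,m-1}=1+\sigma_1+\sigma_2\sigma_1+\dots+\sigma_{m-1}\cdots\sigma_2\sigma_1\in k\mathbb B_m .$$ For $|\underline m|=m$ let $V_{\underline m}\subseteq V^{\otimes m}$ be the span of all $x_{i_1}\otimes\dots\otimes x_{i_m}$ in which each index $i$ occurs exactly $m_i$ times. **Theorem.**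 Let $\underline m\in\mathbb N_0^n$ with $m=|\underline m|\ge 2$. Assume that $P_{\underline m}(q)=0$ and that $P_{\underline l}(q)\neq0$ for all $\underline l<\underline m$ with $|\underline l|\ge2$. Let $d'=N(\underline m)/\operatorname{ord}(Q_{\underline m}(q))$, where $\operatorname{ord}$ denotes the multiplicative order in $k^\times$ (under these assumptions $Q_{\underline m}(q)^{N(\underline m)}=1$, so $d'$ is a positive integer), and let $$n_1(q)=\sum_{i:\,m_i>0}\ \sum_{r\mid\gcd(\underline m-e_i),\ r\mid d'}\ell_{(\underline m-e_i)/r},\qquad n_2(q)=\sum_{r\mid\gcd(\underline m),\ r\mid d'}\ell_{\underline m/r}.$$ Then $$\dim\ker\bigl(\rho_m(S_{1,m-1})|_{V_{\underline m}}\bigr)=n_1(q)-n_2(q).$$ -/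

import Mathlib

open scoped TensorProduct

noncomputable section

namespace ShuffleKernel

/-! ### Degrees, words, Lyndon words -/

/-- The standard basis vector `e_i` of `ℕ₀ⁿ`. -/
def e {n : ℕ} (i : Fin n) : Fin n → ℕ := Pi.single i 1

/-- `|m| = m₁ + ⋯ + mₙ`. -/
def size {n : ℕ} (m : Fin n → ℕ) : ℕ := ∑ i, m i

/-- `gcd(m) = gcd(m₁, …, mₙ)`. -/
def gcdVec {n : ℕ} (m : Fin n → ℕ) : ℕ := Finset.univ.gcd m

/-- `m / k = (m₁ / k, …, mₙ / k)`; only used when `k` divides every entry of `m`. -/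
def divVec {n : ℕ} (m : Fin n → ℕ) (k : ℕ) : Fin n → ℕ := fun i => m i / k

/-- `N(m) = gcd {mᵢ(mᵢ - 1), mⱼmₖ | i, j, k with j < k}`. -/
def N {n : ℕ} (m : Fin n → ℕ) : ℕ :=
  Nat.gcd (Finset.univ.gcd fun i => m i * (m i - 1))
    ((Finset.univ.filter fun a : Fin n × Fin n => a.1 < a.2).gcd fun a => m a.1 * m a.2)

/-- The degree of a word over the alphabet `{1, …, n}`: the number of occurrences of each letter. -/
def wordDegree {n : ℕ} (w : List (Fin n)) : Fin n → ℕ := fun i => w.count i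

/-- A nonempty word `w` is Lyndon if `w ≤ v` lexicographically for every decomposition `w = uv`
into nonempty words. -/
def IsLyndon {n : ℕ} (w : List (Fin n)) : Prop :=
  w ≠ [] ∧ ∀ u v : List (Fin n), u ≠ [] → v ≠ [] → w = u ++ v → w ≤ v

/-- `ℓ_m`, the number of Lyndon words of degree `m`. -/
def lyndonCount {n : ℕ} (m : Fin n → ℕ) : ℕ :=
  {w : List (Fin n) | IsLyndon w ∧ wordDegree w = m}.ncard

/-! ### The polynomials `P_m` and `Q_m` in `ℤ[p_ij]` -/

/-- The variable `p_ij`. -/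
def p {n : ℕ} (i j : Fin n) : MvPolynomial (Fin n × Fin n) ℤ := MvPolynomial.X (i, j)

/-- `(m)_q = 1 + q + ⋯ + q^(m-1)`. -/
def qInt {R : Type*} [Semiring R] (m : ℕ) (q : R) : R := ∑ t ∈ Finset.range m, q ^ t

open Classical in
/-- The polynomial `P_m`. In each case the index `i`, or the pair `(i, j) = (a.1, a.2)`, is
determined by `m` when `|m| ≥ 2`, except that `i` and `j` may be exchanged when `mᵢ = mⱼ`; then the
polynomial is symmetric in `i` and `j`. -/
def P {n : ℕ} (m : Fin n → ℕ) : MvPolynomial (Fin n × Fin n) ℤ :=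
  if h : ∃ i : Fin n, 0 < m i ∧ m = m i • e i then
    let i := h.choose
    qInt (m i) (p i i)
  else if h : ∃ a : Fin n × Fin n, a.1 ≠ a.2 ∧ 0 < m a.2 ∧ m = e a.1 + m a.2 • e a.2 then
    let i := h.choose.1
    let j := h.choose.2
    1 - p j j ^ (m j - 1) * (p i j * p j i)
  else if h : ∃ a : Fin n × Fin n, a.1 ≠ a.2 ∧ 0 < m a.2 ∧ m = 2 • e a.1 + m a.2 • e a.2 then
    let i := h.choose.1
    let j := h.choose.2
    1 + p j j ^ (m j * (m j - 1) / 2) * (-(p i j * p j i)) ^ m j * p i i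
  else if h : ∃ a : Fin n × Fin n, a.1 ≠ a.2 ∧ m = 3 • e a.1 + 3 • e a.2 then
    let i := h.choose.1
    let j := h.choose.2
    qInt 3 (p i i ^ 2 * (p i j * p j i) ^ 3 * p j j ^ 2)
  else if h : ∃ a : Fin n × Fin n, a.1 ≠ a.2 ∧ m = 3 • e a.1 + 4 • e a.2 then
    let i := h.choose.1
    let j := h.choose.2
    (1 - p i i ^ 2 * (p i j * p j i) ^ 4 * p j j ^ 4) *
      qInt 3 (p i i * (p i j * p j i) ^ 2 * p j j ^ 2)
  else if h : ∃ a : Fin n × Fin n, a.1 ≠ a.2 ∧ m = 3 • e a.1 + 6 • e a.2 then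
    let i := h.choose.1
    let j := h.choose.2
    (1 - p i i * (p i j * p j i) ^ 3 * p j j ^ 5) *
      qInt 3 (p i i ^ 2 * (p i j * p j i) ^ 6 * p j j ^ 10)
  else if h : ∃ a : Fin n × Fin n, a.1 ≠ a.2 ∧ m = 4 • e a.1 + 4 • e a.2 then
    let i := h.choose.1
    let j := h.choose.2
    (1 + p i i ^ 3 * (p i j * p j i) ^ 4 * p j j ^ 3) *
      (1 + p i i ^ 6 * (p i j * p j i) ^ 8 * p j j ^ 6)
  else
    1 - (∏ i, p i i ^ (m i * (m i - 1))) *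
      ∏ a : Fin n × Fin n with a.1 < a.2, (p a.1 a.2 * p a.2 a.1) ^ (m a.1 * m a.2)

/-- The monomial `Q_m`. -/
def Q {n : ℕ} (m : Fin n → ℕ) : MvPolynomial (Fin n × Fin n) ℤ :=
  (∏ i, p i i ^ (m i * (m i - 1) / N m)) *
    ∏ a : Fin n × Fin n with a.1 < a.2, (p a.1 a.2 * p a.2 a.1) ^ (m a.1 * m a.2 / N m)

/-- The value `f(q)` of a polynomial `f ∈ ℤ[p_ij]` at a matrix `q = (q_ij)`. -/
def evalAt {n : ℕ} {K : Type*} [CommRing K] (q : Fin n → Fin n → K)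
    (f : MvPolynomial (Fin n × Fin n) ℤ) : K :=
  MvPolynomial.aeval (fun a : Fin n × Fin n => q a.1 a.2) f

/-! ### The numbers `n₁(q)` and `n₂(q)` -/

/-- `d' = N(m) / ord(Q_m(q))`, where `ord` is the multiplicative order. -/
def dPrime {n : ℕ} {K : Type*} [Field K] (q : Fin n → Fin n → K) (m : Fin n → ℕ) : ℕ :=
  N m / orderOf (evalAt q (Q m))

/-- `n₁(q)`. -/
def n₁ {n : ℕ} {K : Type*} [Field K] (q : Fin n → Fin n → K) (m : Fin n → ℕ) : ℕ :=
  ∑ i : Fin n with 0 < m i,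
    ∑ k ∈ (gcdVec (m - e i)).divisors with k ∣ dPrime q m, lyndonCount (divVec (m - e i) k)

/-- `n₂(q)`. -/
def n₂ {n : ℕ} {K : Type*} [Field K] (q : Fin n → Fin n → K) (m : Fin n → ℕ) : ℕ :=
  ∑ k ∈ (gcdVec m).divisors with k ∣ dPrime q m, lyndonCount (divVec m k)

/-! ### The braid monoid and the shuffle elements -/

/-- The defining relations of the braid monoid on `r` strands; the generator with index
`i : Fin (r - 1)` is the one usually written `σ_(i+1)`. -/
inductive BraidRel (r : ℕ) : FreeMonoid (Fin (r - 1)) → FreeMonoid (Fin (r - 1)) → Prop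
  | comm (i j : Fin (r - 1)) (h : (i : ℕ) + 2 ≤ j) :
      BraidRel r (FreeMonoid.of i * FreeMonoid.of j) (FreeMonoid.of j * FreeMonoid.of i)
  | braid (i j : Fin (r - 1)) (h : (j : ℕ) = i + 1) :
      BraidRel r (FreeMonoid.of i * FreeMonoid.of j * FreeMonoid.of i)
        (FreeMonoid.of j * FreeMonoid.of i * FreeMonoid.of j)

/-- The braid monoid on `r` strands. -/
abbrev BraidMonoid (r : ℕ) : Type := PresentedMonoid (BraidRel r)

/-- The generators of the braid monoid, indexed from `0`. -/
def σ {r : ℕ} (i : Fin (r - 1)) : BraidMonoid r := PresentedMonoid.of (BraidRel r) i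

/-- The product `σ_t σ_(t-1) ⋯ σ_1` (generators counted from `1`), for `t ≤ r - 1`. -/
def descProd (r t : ℕ) : BraidMonoid r :=
  (((List.finRange (r - 1)).take t).reverse.map σ).prod

/-- `S_{1,s} = 1 + σ_1 + σ_2 σ_1 + ⋯ + σ_s ⋯ σ_2 σ_1` in the monoid ring of the braid monoid on `r`
strands, for `s < r`. -/
def S (K : Type*) [Semiring K] (r s : ℕ) : MonoidAlgebra K (BraidMonoid r) :=
  ∑ t ∈ Finset.range (s + 1), MonoidAlgebra.of K (BraidMonoid r) (descProd r t)

/-! ### Braided vector spaces of diagonal type -/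

section Braiding

variable {K : Type*} [Field K] {V : Type*} [AddCommGroup V] [Module K V]

/-- The braiding `c(xᵢ ⊗ xⱼ) = q_ij xⱼ ⊗ xᵢ` of diagonal type. -/
def diagBraiding {n : ℕ} (x : Module.Basis (Fin n) K V) (q : Fin n → Fin n → K) :
    V ⊗[K] V →ₗ[K] V ⊗[K] V :=
  (x.tensorProduct x).constr K fun a => q a.1 a.2 • (x a.2 ⊗ₜ[K] x a.1)

theorem diagBraiding_apply {n : ℕ} (x : Module.Basis (Fin n) K V) (q : Fin n → Fin n → K)
    (i j : Fin n) : diagBraiding x q (x i ⊗ₜ[K] x j) = q i j • (x j ⊗ₜ[K] x i) := by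
  have h := (x.tensorProduct x).constr_basis K
    (fun a : Fin n × Fin n => q a.1 a.2 • (x a.2 ⊗ₜ[K] x a.1)) (i, j)
  rwa [Module.Basis.tensorProduct_apply] at h

/-- The linear map `a ⊗ b ↦ v₁ ⊗ ⋯ ⊗ a ⊗ ⋯ ⊗ b ⊗ ⋯ ⊗ v_r` which puts `a` and `b` at the two
different positions `i` and `j` of the pure tensor of `v`. -/
def insertTwo {r : ℕ} (i j : Fin r) (hij : i ≠ j) (v : Fin r → V) :
    V ⊗[K] V →ₗ[K] TensorPower K r V :=
  TensorProduct.lift <| LinearMap.mk₂ K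
    (fun a b => PiTensorProduct.tprod K (Function.update (Function.update v i a) j b))
    (fun a a' b => by
      simp only [Function.update_comm hij, MultilinearMap.map_update_add])
    (fun t a b => by
      simp only [Function.update_comm hij, MultilinearMap.map_update_smul])
    (fun a b b' => by simp only [MultilinearMap.map_update_add])
    (fun t a b => by simp only [MultilinearMap.map_update_smul])

theorem insertTwo_tmul {r : ℕ} (i j : Fin r) (hij : i ≠ j) (v : Fin r → V) (a b : V) :
    insertTwo (K := K) i j hij v (a ⊗ₜ[K] b) =
      PiTensorProduct.tprod K (Function.update (Function.update v i a) j b) := rfl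

theorem insertTwo_update_left {r : ℕ} (i j : Fin r) (hij : i ≠ j) (v : Fin r → V) (a : V) :
    insertTwo (K := K) i j hij (Function.update v i a) = insertTwo i j hij v := by
  ext b c
  simp [insertTwo_tmul]

theorem insertTwo_update_right {r : ℕ} (i j : Fin r) (hij : i ≠ j) (v : Fin r → V) (a : V) :
    insertTwo (K := K) i j hij (Function.update v j a) = insertTwo i j hij v := by
  ext b c
  simp [insertTwo_tmul, Function.update_comm hij]

theorem insertTwo_update_add {r : ℕ} (i j : Fin r) (hij : i ≠ j) (v : Fin r → V) (t : Fin r)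
    (hti : t ≠ i) (htj : t ≠ j) (a b : V) :
    insertTwo (K := K) i j hij (Function.update v t (a + b)) =
      insertTwo i j hij (Function.update v t a) + insertTwo i j hij (Function.update v t b) := by
  ext c d
  simp [insertTwo_tmul, Function.update_comm hti, Function.update_comm htj]

theorem insertTwo_update_smul {r : ℕ} (i j : Fin r) (hij : i ≠ j) (v : Fin r → V) (t : Fin r)
    (hti : t ≠ i) (htj : t ≠ j) (s : K) (a : V) :
    insertTwo (K := K) i j hij (Function.update v t (s • a)) =
      s • insertTwo i j hij (Function.update v t a) := by
  ext c d
  simp [insertTwo_tmul, Function.update_comm hti, Function.update_comm htj]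

/-- An endomorphism `c` of `V ⊗ V` applied to the tensor factors at the positions `i ≠ j` of the
`r`-fold tensor power of `V`. -/
def applyAt {r : ℕ} (c : V ⊗[K] V →ₗ[K] V ⊗[K] V) (i j : Fin r) (hij : i ≠ j) :
    Module.End K (TensorPower K r V) :=
  PiTensorProduct.lift <| MultilinearMap.mk'
    (fun v : Fin r → V => insertTwo i j hij v (c (v i ⊗ₜ[K] v j)))
    (fun v t a b => by
      by_cases hti : t = i
      · subst hti
        simp [insertTwo_update_left, Function.update_of_ne hij.symm, TensorProduct.add_tmul]
      · by_cases htj : t = j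
        · subst htj
          simp [insertTwo_update_right, Function.update_of_ne hij, TensorProduct.tmul_add]
        · simp [insertTwo_update_add i j hij v t hti htj, Function.update_of_ne (Ne.symm hti),
            Function.update_of_ne (Ne.symm htj)])
    (fun v t s a => by
      by_cases hti : t = i
      · subst hti
        simp [insertTwo_update_left, Function.update_of_ne hij.symm, ← TensorProduct.smul_tmul']
      · by_cases htj : t = j
        · subst htj
          simp [insertTwo_update_right, Function.update_of_ne hij]
        · simp [insertTwo_update_smul i j hij v t hti htj, Function.update_of_ne (Ne.symm hti),
            Function.update_of_ne (Ne.symm htj)])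

theorem applyAt_tprod {r : ℕ} (c : V ⊗[K] V →ₗ[K] V ⊗[K] V) (i j : Fin r) (hij : i ≠ j)
    (v : Fin r → V) :
    applyAt c i j hij (PiTensorProduct.tprod K v) = insertTwo i j hij v (c (v i ⊗ₜ[K] v j)) := by
  simp [applyAt, PiTensorProduct.lift.tprod]

/-- The left one of the two tensor factors on which the generator with index `i` acts. -/
def posL {r : ℕ} (i : Fin (r - 1)) : Fin r := ⟨i, by omega⟩

/-- The right one of the two tensor factors on which the generator with index `i` acts. -/
def posR {r : ℕ} (i : Fin (r - 1)) : Fin r := ⟨i + 1, by omega⟩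

theorem posL_ne_posR {r : ℕ} (i : Fin (r - 1)) : posL i ≠ posR i := by
  simp [posL, posR, Fin.ext_iff]

variable {n : ℕ} (x : Module.Basis (Fin n) K V) (q : Fin n → Fin n → K)

/-- The tensor `x_{w₁} ⊗ ⋯ ⊗ x_{w_r}` of a word `w`. -/
def wordTensor {r : ℕ} (w : Fin r → Fin n) : TensorPower K r V :=
  PiTensorProduct.tprod K fun t => x (w t)

/-- The braiding applied to two neighbouring tensor factors. -/
def braidOp {r : ℕ} (i : Fin (r - 1)) : Module.End K (TensorPower K r V) :=
  applyAt (diagBraiding x q) (posL i) (posR i) (posL_ne_posR i)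

theorem braidOp_wordTensor {r : ℕ} (i : Fin (r - 1)) (w : Fin r → Fin n) :
    braidOp x q i (wordTensor x w) =
      q (w (posL i)) (w (posR i)) • wordTensor x (w ∘ Equiv.swap (posL i) (posR i)) := by
  rw [wordTensor, braidOp, applyAt_tprod, diagBraiding_apply, map_smul, insertTwo_tmul]
  congr 2
  funext t
  by_cases h2 : t = posR i
  · subst h2; simp
  · by_cases h1 : t = posL i
    · subst h1; simp [Function.update_of_ne h2]
    · simp [Function.update_of_ne h2, Function.update_of_ne h1, Equiv.swap_apply_of_ne_of_ne h1 h2]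

theorem end_ext {r : ℕ} {f g : Module.End K (TensorPower K r V)}
    (h : ∀ w : Fin r → Fin n, f (wordTensor x w) = g (wordTensor x w)) : f = g := by
  refine (Basis.piTensorProduct fun _ : Fin r => x).ext fun w => ?_
  rw [Basis.piTensorProduct_apply]
  exact h w

theorem braidOp_comm {r : ℕ} (i j : Fin (r - 1)) (h : (i : ℕ) + 2 ≤ j) :
    braidOp x q i * braidOp x q j = braidOp x q j * braidOp x q i := by
  refine end_ext x fun w => ?_
  have h1 : posL i ≠ posL j := by simp only [posL, ne_eq, Fin.mk.injEq]; omega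
  have h2 : posL i ≠ posR j := by simp only [posL, posR, ne_eq, Fin.mk.injEq]; omega
  have h3 : posR i ≠ posL j := by simp only [posL, posR, ne_eq, Fin.mk.injEq]; omega
  have h4 : posR i ≠ posR j := by simp only [posR, ne_eq, Fin.mk.injEq]; omega
  have hw : (w ∘ Equiv.swap (posL j) (posR j)) ∘ Equiv.swap (posL i) (posR i) =
      (w ∘ Equiv.swap (posL i) (posR i)) ∘ Equiv.swap (posL j) (posR j) := by
    funext t
    simp only [Function.comp_apply, Equiv.swap_apply_def]
    grind
  simp only [Module.End.mul_apply, braidOp_wordTensor, map_smul, smul_smul, hw,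
    Function.comp_apply, Equiv.swap_apply_of_ne_of_ne h1 h2, Equiv.swap_apply_of_ne_of_ne h3 h4,
    Equiv.swap_apply_of_ne_of_ne h1.symm h3.symm, Equiv.swap_apply_of_ne_of_ne h2.symm h4.symm]
  rw [mul_comm]

theorem braidOp_braid {r : ℕ} (i j : Fin (r - 1)) (h : (j : ℕ) = i + 1) :
    braidOp x q i * braidOp x q j * braidOp x q i =
      braidOp x q j * braidOp x q i * braidOp x q j := by
  refine end_ext x fun w => ?_
  have h1 : posL j = posR i := by simp only [posL, posR, Fin.mk.injEq]; omega
  have h2 : posL i ≠ posR j := by simp only [posL, posR, ne_eq, Fin.mk.injEq]; omega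
  have h3 : posR i ≠ posR j := by simp only [posR, ne_eq, Fin.mk.injEq]; omega
  have h4 : posL i ≠ posR i := posL_ne_posR i
  have hw : ((w ∘ Equiv.swap (posL i) (posR i)) ∘ Equiv.swap (posR i) (posR j)) ∘
        Equiv.swap (posL i) (posR i) =
      ((w ∘ Equiv.swap (posR i) (posR j)) ∘ Equiv.swap (posL i) (posR i)) ∘
        Equiv.swap (posR i) (posR j) := by
    funext t
    simp only [Function.comp_apply, Equiv.swap_apply_def]
    grind
  simp only [Module.End.mul_apply, braidOp_wordTensor, map_smul, smul_smul, h1, hw,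
    Function.comp_apply, Equiv.swap_apply_left, Equiv.swap_apply_right,
    Equiv.swap_apply_of_ne_of_ne h4 h2, Equiv.swap_apply_of_ne_of_ne h2.symm h3.symm]
  congr 1
  ring

/-- The representation `ρ_r` of the monoid ring of the braid monoid on the `r`-fold tensor power of
`V`; the generator `σ_i` acts by the braiding on the `i`-th and `(i+1)`-th tensor factors. -/
def ρ (r : ℕ) : MonoidAlgebra K (BraidMonoid r) →ₐ[K] Module.End K (TensorPower K r V) :=
  MonoidAlgebra.lift K _ (BraidMonoid r) <|
    PresentedMonoid.lift (fun i => braidOp x q i) (by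
      rintro _ _ (⟨i, j, h⟩ | ⟨i, j, h⟩)
      · simpa using braidOp_comm x q i j h
      · simpa using braidOp_braid x q i j h)

/-- `V_m`, the homogeneous component of degree `m` of the tensor algebra of `V`: the span, inside
the tensor power of exponent `|m|`, of the tensors of all words of degree `m`. -/
def component (m : Fin n → ℕ) : Submodule K (TensorPower K (size m) V) :=
  Submodule.span K
    {y | ∃ w : Fin (size m) → Fin n, wordDegree (List.ofFn w) = m ∧ y = wordTensor x w}

end Braiding

end ShuffleKernel

end

/-
`σ_t ⋯ σ_1` moves the first letter of a word `t` places to the right, so it acts monomially on the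
words of degree `m`. Put `C = σ_{|m|-1} ⋯ σ_1`, which rotates a word, and
`X = σ_{|m|-1} ⋯ σ_2 σ_1²`, which rotates all letters but the first one. The braid relations give
`(1 - C) S_{1,|m|-1} = S_{1,|m|-2} (1 - X)`. On `V_m` the operator `S_{1,|m|-2}` is the direct sum,
over the last letter `i`, of the operators `S` in the degrees `m - e_i`; as long as these are
injective, `ker S_{1,|m|-1} ⊆ ker (1 - X)`, and `S_{1,|m|-1}` maps `ker (1 - X)` onto `ker (1 - C)`
as soon as `C` and `X` have finite order. The dimensions of the latter two kernels count the orbits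
of words under rotation on which the product of the scalars is `1`. Those orbits correspond to the
powers of Lyndon words whose exponent divides `d'`, and this yields `n₁ - n₂`. By induction on the
degree, the first `m` for which `S_{1,|m|-1}` fails to be injective is the first one for which `P_m`
vanishes.
-/

noncomputable section

namespace ShuffleKernel

section Words

variable {α : Type*}

/-- The period of a word under cyclic rotation: the least `d > 0` such that rotating `w` by `d`
letters gives back `w`. -/
def rotPeriod (w : List α) : ℕ := Function.minimalPeriod (fun l : List α => l.rotate 1) w

/-- The exponent of a word: the largest `k` such that `w` is the `k`-th power of another word
(and `0` for the empty word). -/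
def exponent (w : List α) : ℕ := w.length / rotPeriod w

/-- The power `u ⋯ u` of a word, with `k` factors. -/
def wordPow (u : List α) (k : ℕ) : List α := (List.replicate k u).flatten

theorem rotate_one_iterate (i : ℕ) :
    (fun w : List α => w.rotate 1)^[i] = fun w => w.rotate i := by
  induction i with
  | zero => funext w; exact (List.rotate_zero w).symm
  | succ i ih => funext w; rw [Function.iterate_succ_apply', ih, List.rotate_rotate]

theorem rotate_eq_self_iff (w : List α) (i : ℕ) : w.rotate i = w ↔ rotPeriod w ∣ i := by
  rw [rotPeriod, ← Function.isPeriodicPt_iff_minimalPeriod_dvd, Function.IsPeriodicPt,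
    Function.IsFixedPt, rotate_one_iterate]

theorem rotPeriod_dvd_length (w : List α) : rotPeriod w ∣ w.length :=
  (rotate_eq_self_iff w _).1 (List.rotate_length w)

theorem rotPeriod_eq_of_rotate_iff {v w : List α} (h : ∀ i, v.rotate i = v ↔ w.rotate i = w) :
    rotPeriod v = rotPeriod w :=
  Nat.dvd_antisymm ((rotate_eq_self_iff v _).1 ((h _).2 ((rotate_eq_self_iff w _).2 dvd_rfl)))
    ((rotate_eq_self_iff w _).1 ((h _).1 ((rotate_eq_self_iff v _).2 dvd_rfl)))

theorem exponent_mul_rotPeriod (w : List α) : exponent w * rotPeriod w = w.length :=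
  Nat.div_mul_cancel (rotPeriod_dvd_length w)

theorem exponent_pos {w : List α} (hw : w ≠ []) : 0 < exponent w :=
  Nat.pos_of_mul_pos_right (exponent_mul_rotPeriod w ▸ List.length_pos_of_ne_nil hw)

theorem exponent_eq_one_iff {w : List α} (hw : w ≠ []) :
    exponent w = 1 ↔ rotPeriod w = w.length := by
  have hpos := List.length_pos_of_ne_nil hw
  rw [exponent, Nat.div_eq_iff_eq_mul_left
    (Nat.pos_of_dvd_of_pos (rotPeriod_dvd_length w) hpos) (rotPeriod_dvd_length w),
    Nat.one_mul, eq_comm]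

theorem wordPow_zero (u : List α) : wordPow u 0 = [] := rfl

theorem wordPow_succ (u : List α) (k : ℕ) : wordPow u (k + 1) = u ++ wordPow u k := rfl

theorem length_wordPow (u : List α) (k : ℕ) : (wordPow u k).length = k * u.length := by
  simp [wordPow]

theorem wordPow_inj {u v : List α} (huv : u.length = v.length) {k : ℕ} (hk : 0 < k) :
    wordPow u k = wordPow v k ↔ u = v := by
  refine ⟨fun h => ?_, fun h => h ▸ rfl⟩
  obtain ⟨k, rfl⟩ := Nat.exists_eq_succ_of_ne_zero hk.ne'
  rw [Nat.succ_eq_add_one, wordPow_succ, wordPow_succ] at h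
  exact (List.append_inj h huv).1

theorem cons_wordPow_append_singleton (a : α) (v : List α) (k : ℕ) :
    a :: wordPow (v ++ [a]) k = wordPow (a :: v) k ++ [a] := by
  induction k with
  | zero => rfl
  | succ k ih => simp [wordPow_succ, ← ih]

theorem rotate_wordPow (u : List α) (k i : ℕ) :
    (wordPow u k).rotate i = wordPow (u.rotate i) k := by
  have rotate_one (u : List α) : (wordPow u k).rotate 1 = wordPow (u.rotate 1) k := by
    rcases u with - | ⟨a, v⟩ <;> rcases k with - | k
    · rfl
    · simp [wordPow]
    · rfl
    · simp [wordPow_succ, cons_wordPow_append_singleton]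
  induction i with
  | zero => simp
  | succ i ih => rw [← List.rotate_rotate, ih, rotate_one, List.rotate_rotate]

theorem exponent_wordPow (u : List α) {k : ℕ} (hk : 0 < k) :
    exponent (wordPow u k) = k * exponent u := by
  have hperiod : rotPeriod (wordPow u k) = rotPeriod u := rotPeriod_eq_of_rotate_iff fun i => by
    rw [rotate_wordPow, wordPow_inj (List.length_rotate ..) hk]
  rw [exponent, exponent, hperiod, length_wordPow, Nat.mul_div_assoc _ (rotPeriod_dvd_length u)]

theorem eq_wordPow_of_append_comm {u v : List α} {k : ℕ} (h : u ++ v = v ++ u)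
    (hlen : v.length = k * u.length) : v = wordPow u k := by
  induction k generalizing v with
  | zero => simpa [wordPow] using hlen
  | succ k ih =>
    rw [Nat.succ_mul] at hlen
    obtain ⟨v, rfl⟩ : u <+: v := List.prefix_of_prefix_length_le (l₃ := v ++ u)
      (h ▸ List.prefix_append u v) (List.prefix_append v u) (by omega)
    rw [List.length_append] at hlen
    rw [wordPow_succ, ← ih (by simpa using h) (by omega)]

theorem wordPow_take_rotPeriod (w : List α) :
    wordPow (w.take (rotPeriod w)) (exponent w) = w := by
  rcases eq_or_ne w [] with rfl | hw
  · simp [exponent, wordPow]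
  set d := rotPeriod w
  have hlen : exponent w * d = w.length := exponent_mul_rotPeriod w
  have hle : d ≤ w.length := Nat.le_of_dvd (List.length_pos_of_ne_nil hw) (rotPeriod_dvd_length w)
  refine (eq_wordPow_of_append_comm ?_ ?_).symm
  · calc w.take d ++ w
        = w.take d ++ (w.drop d ++ w.take d) := by
          rw [← List.rotate_eq_drop_append_take hle, (rotate_eq_self_iff w d).2 dvd_rfl]
      _ = w ++ w.take d := by rw [← List.append_assoc, List.take_append_drop]
  · rw [List.length_take, Nat.min_eq_left hle, hlen]

theorem exponent_take_rotPeriod {w : List α} (hw : w ≠ []) :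
    exponent (w.take (rotPeriod w)) = 1 := by
  have h := exponent_wordPow (w.take (rotPeriod w)) (exponent_pos hw)
  rw [wordPow_take_rotPeriod] at h
  exact Nat.eq_of_mul_eq_mul_left (exponent_pos hw) (by rw [← h, Nat.mul_one])

end Words

section Necklaces

variable {α : Type*} [LinearOrder α]

/-- A necklace is a word which is lexicographically minimal among its rotations; each class of
words under rotation contains exactly one. -/
def IsNecklace (w : List α) : Prop := ∀ i, w ≤ w.rotate i

theorem exists_isNecklace_rotate (w : List α) : ∃ i, IsNecklace (w.rotate i) := by
  rcases eq_or_ne w [] with rfl | hw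
  · exact ⟨0, fun i => by simp⟩
  obtain ⟨i, -, hmin⟩ := Finset.exists_min_image (Finset.range w.length) (fun i => w.rotate i)
    ⟨0, by simpa [List.length_pos_iff] using hw⟩
  refine ⟨i, fun j => ?_⟩
  rw [List.rotate_rotate, ← List.rotate_mod w (i + j)]
  exact hmin _ (Finset.mem_range.2 (Nat.mod_lt _ (List.length_pos_of_ne_nil hw)))

theorem IsNecklace.eq_of_isRotated {v w : List α} (hv : IsNecklace v) (hw : IsNecklace w)
    (h : v ~r w) : v = w := by
  obtain ⟨j, hj⟩ := h.symm
  obtain ⟨i, hi⟩ := h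
  exact le_antisymm (hi ▸ hv i) (hj ▸ hw j)

theorem append_lt_append_of_not_isPrefix {v w : List α} (h : v < w) (hp : ¬ v <+: w)
    (s t : List α) : v ++ s < w ++ t := by
  induction v generalizing w with
  | nil => exact absurd List.nil_prefix hp
  | cons a v ih =>
    rcases w with - | ⟨b, w⟩
    · exact absurd h (List.not_lt_nil _)
    rw [List.cons_append, List.cons_append, List.cons_lt_cons_iff]
    rcases List.cons_lt_cons_iff.1 h with hab | ⟨rfl, hvw⟩
    · exact Or.inl hab
    · exact Or.inr ⟨rfl, ih hvw (by simpa using hp)⟩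

theorem append_lt_append_of_length_eq {v w : List α} (h : v < w) (hlen : v.length = w.length)
    (s t : List α) : v ++ s < w ++ t :=
  append_lt_append_of_not_isPrefix h (fun hp => h.ne (hp.eq_of_length hlen)) s t

theorem wordPow_le_wordPow_iff {u v : List α} (hlen : u.length = v.length) {k : ℕ} (hk : 0 < k) :
    wordPow u k ≤ wordPow v k ↔ u ≤ v := by
  have wordPow_lt {u v : List α} (hlen : u.length = v.length) (h : u < v) :
      wordPow u k < wordPow v k := by
    obtain ⟨k, rfl⟩ := Nat.exists_eq_succ_of_ne_zero hk.ne'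
    exact append_lt_append_of_length_eq h hlen _ _
  refine ⟨fun h => not_lt.1 fun hvu => h.not_gt (wordPow_lt hlen.symm hvu), fun h => ?_⟩
  rcases h.lt_or_eq with h | rfl
  · exact (wordPow_lt hlen h).le
  · exact le_rfl

theorem isNecklace_wordPow_iff (u : List α) {k : ℕ} (hk : 0 < k) :
    IsNecklace (wordPow u k) ↔ IsNecklace u :=
  forall_congr' fun i => by
    rw [rotate_wordPow, wordPow_le_wordPow_iff (List.length_rotate ..).symm hk]

end Necklaces

section Lyndon

variable {n : ℕ}

/-- If `w = uv` with `v < w`, then comparing `v` with the prefix of `w` of the same length shows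
that one of the rotations `vu` and `tv`, where `w = vt`, is smaller than `w`. -/
theorem isLyndon_iff_lt_append {w : List (Fin n)} : IsLyndon w ↔
    w ≠ [] ∧ ∀ u v : List (Fin n), u ≠ [] → v ≠ [] → w = u ++ v → w < v ++ u := by
  refine and_congr_right fun _ => ⟨fun h u v hu hv huv => ?_, fun h u v hu hv huv => ?_⟩
  · have hlen : v.length < w.length := by
      rw [huv, List.length_append]; exact Nat.lt_add_of_pos_left (List.length_pos_of_ne_nil hu)
    have hlt : w < v := (h u v hu hv huv).lt_of_ne (by rintro rfl; exact lt_irrefl _ hlen)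
    simpa using append_lt_append_of_not_isPrefix hlt (fun hp => hp.length_le.not_gt hlen) [] u
  · by_contra hlt
    rw [not_le] at hlt
    have hp : v <+: w := by
      by_contra hp
      have hvu := append_lt_append_of_not_isPrefix hlt hp u []
      rw [List.append_nil] at hvu
      exact lt_asymm hvu (h u v hu hv huv)
    obtain ⟨t, ht⟩ := hp
    have hlen : t.length = u.length := by
      have hlen := congrArg List.length (ht.trans huv)
      rw [List.length_append, List.length_append] at hlen
      omega
    have htu : t < u := lt_of_not_ge fun hut => by
      have hvt : v ++ t < v ++ u := ht ▸ h u v hu hv huv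
      rcases hut.lt_or_eq with hut | rfl
      · exact lt_asymm hvt (List.append_left_lt hut)
      · exact lt_irrefl _ hvt
    have ht0 : t ≠ [] := by
      rw [← List.length_pos_iff, hlen]; exact List.length_pos_of_ne_nil hu
    have hut := h v t hv ht0 ht.symm
    rw [huv] at hut
    exact lt_asymm hut (append_lt_append_of_length_eq htu hlen v v)

theorem isLyndon_iff_lt_rotate {w : List (Fin n)} : IsLyndon w ↔
    w ≠ [] ∧ ∀ i, 0 < i → i < w.length → w < w.rotate i := by
  rw [isLyndon_iff_lt_append]
  refine and_congr_right fun hw => ⟨fun h i hi hiw => ?_, fun h u v hu hv huv => ?_⟩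
  · rw [List.rotate_eq_drop_append_take hiw.le]
    refine h _ _ ?_ ?_ (List.take_append_drop i w).symm
    · simp [hi.ne', hw]
    · simpa using hiw
  · have hlt := h u.length (List.length_pos_of_ne_nil hu)
      (by rw [huv]; simpa using List.length_pos_of_ne_nil hv)
    nth_rw 2 [huv] at hlt
    rwa [List.rotate_append_length_eq] at hlt

theorem isLyndon_iff_isNecklace {w : List (Fin n)} :
    IsLyndon w ↔ w ≠ [] ∧ IsNecklace w ∧ exponent w = 1 := by
  rw [isLyndon_iff_lt_rotate]
  refine and_congr_right fun hw => ?_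
  have hpos := List.length_pos_of_ne_nil hw
  rw [exponent_eq_one_iff hw]
  refine ⟨fun h => ⟨fun i => ?_, ?_⟩, fun ⟨hle, hper⟩ i hi hiw => (hle i).lt_of_ne fun heq => ?_⟩
  · rw [← List.rotate_mod]
    rcases Nat.eq_zero_or_pos (i % w.length) with hi | hi
    · rw [hi, List.rotate_zero]
    · exact (h _ hi (Nat.mod_lt _ hpos)).le
  · by_contra hne
    have hdvd := rotPeriod_dvd_length w
    have hlt := h _ (Nat.pos_of_dvd_of_pos hdvd hpos) ((Nat.le_of_dvd hpos hdvd).lt_of_ne hne)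
    exact hlt.ne ((rotate_eq_self_iff w _).2 dvd_rfl).symm
  · rw [eq_comm, rotate_eq_self_iff, hper] at heq
    exact hiw.not_ge (Nat.le_of_dvd hi heq)

end Lyndon

section Orbits

variable {ι : Type*}

/-- `R` is a transversal for the orbits of `g`: each point is of the form `g^[i] r` for exactly one
`r ∈ R`. -/
def IsOrbitTransversal (g : ι → ι) (R : Finset ι) : Prop := ∀ w, ∃! r, r ∈ R ∧ ∃ i, g^[i] r = w

theorem IsOrbitTransversal.eq_of_iterate_eq {g : ι → ι} {R : Finset ι}
    (hR : IsOrbitTransversal g R) {r s : ι} (hr : r ∈ R) (hs : s ∈ R) {i j : ℕ}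
    (h : g^[i] r = g^[j] s) : r = s :=
  (hR (g^[i] r)).unique ⟨hr, i, rfl⟩ ⟨hs, j, h.symm⟩

variable {g : ι → ι}

theorem minimalPeriod_pos_of_injective [Finite ι] (hg : g.Injective) (w : ι) :
    0 < Function.minimalPeriod g w :=
  Function.minimalPeriod_pos_of_mem_periodicPts (hg.mem_periodicPts w)

theorem card_eq_sum_minimalPeriod [Fintype ι] (hg : g.Injective) {R : Finset ι}
    (hR : IsOrbitTransversal g R) :
    Fintype.card ι = ∑ r ∈ R, Function.minimalPeriod g r := by
  have hcard : ∑ r ∈ R, Function.minimalPeriod g r =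
      (R.sigma fun r => Finset.range (Function.minimalPeriod g r)).card := by
    simp only [Finset.card_sigma, Finset.card_range]
  rw [hcard, ← Finset.card_univ]
  symm
  refine Finset.card_nbij (fun x => g^[x.2] x.1) (fun _ _ => Finset.mem_coe.2 (Finset.mem_univ _))
    ?_ ?_
  · rintro ⟨r, i⟩ hr ⟨s, j⟩ hs h
    simp only [Finset.coe_sigma, Set.mem_sigma_iff, Finset.mem_coe, Finset.mem_range] at hr hs
    obtain rfl : r = s := hR.eq_of_iterate_eq hr.1 hs.1 h
    rw [Function.iterate_injOn_Iio_minimalPeriod (f := g) hr.2 hs.2 h]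
  · rintro w -
    obtain ⟨r, ⟨hr, i, rfl⟩, -⟩ := hR w
    refine ⟨⟨r, i % Function.minimalPeriod g r⟩, ?_, Function.iterate_mod_minimalPeriod_eq⟩
    simpa [hr] using Nat.mod_lt _ (minimalPeriod_pos_of_injective hg r)

end Orbits

section Monomial

variable {ι : Type*} {K : Type*} [Field K]

/-- The monomial operator which sends the basis vector of `w` to `a w` times that of `g w`. -/
def monomialOp (g : ι → ι) (a : ι → K) : Module.End K (ι →₀ K) :=
  Finsupp.linearCombination K fun w => Finsupp.single (g w) (a w)

theorem monomialOp_single (g : ι → ι) (a : ι → K) (w : ι) (x : K) :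
    monomialOp g a (Finsupp.single w x) = Finsupp.single (g w) (a w * x) := by
  rw [monomialOp, Finsupp.linearCombination_single, Finsupp.smul_single, smul_eq_mul, mul_comm]

theorem monomialOp_mul (g h : ι → ι) (a b : ι → K) :
    monomialOp g a * monomialOp h b = monomialOp (g ∘ h) fun w => a (h w) * b w := by
  refine Finsupp.lhom_ext fun w x => ?_
  simp only [Module.End.mul_apply, monomialOp_single, mul_assoc, Function.comp_apply]

theorem monomialOp_congr {g h : ι → ι} {a b : ι → K} (H : ∀ w, g w = h w ∧ a w = b w) :
    monomialOp g a = monomialOp h b := by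
  rw [funext fun w => (H w).1, funext fun w => (H w).2]

theorem monomialOp_id : monomialOp (id : ι → ι) (fun _ => (1 : K)) = 1 :=
  Finsupp.lhom_ext fun w x => by simp [monomialOp_single]

theorem monomialOp_apply_map {g : ι → ι} (hg : g.Injective) (a : ι → K) (v : ι →₀ K) (w : ι) :
    monomialOp g a v (g w) = a w * v w := by
  classical
  induction v using Finsupp.induction_linear with
  | zero => simp
  | add v v' hv hv' => rw [map_add, Finsupp.add_apply, hv, hv', Finsupp.add_apply, mul_add]
  | single u x =>
    simp only [monomialOp_single, Finsupp.single_apply, hg.eq_iff]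
    split_ifs with h
    · rw [h]
    · rw [mul_zero]

/-- The scalar in the action of the `i`-th power of a monomial operator on the basis vector
of `w`. -/
def orbitProd (g : ι → ι) (a : ι → K) (i : ℕ) (w : ι) : K := ∏ j ∈ Finset.range i, a (g^[j] w)

theorem monomialOp_pow (g : ι → ι) (a : ι → K) (i : ℕ) :
    monomialOp g a ^ i = monomialOp g^[i] (orbitProd g a i) := by
  induction i with
  | zero => exact monomialOp_id.symm
  | succ i ih =>
    rw [pow_succ', ih, monomialOp_mul, ← Function.iterate_succ']
    congr 1
    funext w
    rw [orbitProd, orbitProd, Finset.prod_range_succ, mul_comm]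

theorem orbitProd_minimalPeriod_mul (g : ι → ι) (a : ι → K) (w : ι) (k : ℕ) :
    orbitProd g a (Function.minimalPeriod g w * k) w =
      orbitProd g a (Function.minimalPeriod g w) w ^ k := by
  induction k with
  | zero => simp [orbitProd]
  | succ k ih =>
    have hperiod (i : ℕ) : g^[Function.minimalPeriod g w * k + i] w = g^[i] w := by
      rw [add_comm, Function.iterate_add_apply,
        (Function.isPeriodicPt_minimalPeriod g w).mul_const k]
    rw [pow_succ, ← ih, Nat.mul_succ, orbitProd, Finset.prod_range_add]
    simp only [hperiod, orbitProd]

variable {g : ι → ι} {a : ι → K}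

theorem apply_iterate_of_mem_ker (hg : g.Injective) {v : ι →₀ K}
    (hv : v ∈ LinearMap.ker (1 - monomialOp g a)) (i : ℕ) (w : ι) :
    v (g^[i] w) = orbitProd g a i w * v w := by
  have hfix : monomialOp g a v = v := (sub_eq_zero.1 (LinearMap.mem_ker.1 hv)).symm
  have hpow : (monomialOp g a ^ i) v = v := by
    rw [Module.End.pow_apply]; exact Function.iterate_fixed hfix i
  rw [← monomialOp_apply_map (hg.iterate i), ← monomialOp_pow, hpow]

theorem apply_eq_zero_of_mem_ker (hg : g.Injective) {v : ι →₀ K}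
    (hv : v ∈ LinearMap.ker (1 - monomialOp g a)) {w : ι}
    (hw : orbitProd g a (Function.minimalPeriod g w) w ≠ 1) : v w = 0 := by
  have hmul := apply_iterate_of_mem_ker hg hv (Function.minimalPeriod g w) w
  rw [Function.iterate_minimalPeriod] at hmul
  by_contra hvw
  exact hw ((mul_eq_right₀ hvw).1 hmul.symm)

theorem sum_pow_single_mem_ker {r : ι}
    (hr : orbitProd g a (Function.minimalPeriod g r) r = 1) :
    ∑ i ∈ Finset.range (Function.minimalPeriod g r),
      (monomialOp g a ^ i) (Finsupp.single r 1) ∈ LinearMap.ker (1 - monomialOp g a) := by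
  rw [← LinearMap.sum_apply, LinearMap.mem_ker, ← Module.End.mul_apply,
    mul_neg_geom_sum (monomialOp g a), monomialOp_pow, LinearMap.sub_apply, monomialOp_single, hr,
    Function.iterate_minimalPeriod, mul_one, Module.End.one_apply, sub_self]

theorem sum_pow_single_apply [Finite ι] (hg : g.Injective) {R : Finset ι}
    (hR : IsOrbitTransversal g R) {r s : ι} (hr : r ∈ R) (hs : s ∈ R) :
    (∑ i ∈ Finset.range (Function.minimalPeriod g r),
      (monomialOp g a ^ i) (Finsupp.single r (1 : K))) s = Finsupp.single r 1 s := by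
  classical
  rw [Finsupp.finsetSum_apply, Finset.sum_eq_single_of_mem 0
    (Finset.mem_range.2 (minimalPeriod_pos_of_injective hg r)) fun i hi hi0 => ?_]
  · rw [pow_zero, Module.End.one_apply]
  · rw [monomialOp_pow, monomialOp_single, Finsupp.single_eq_of_ne']
    intro his
    have hir : g^[i] r = r := by rw [his, hR.eq_of_iterate_eq hr hs (i := i) (j := 0) his]
    exact Function.not_isPeriodicPt_of_pos_of_lt_minimalPeriod hi0 (Finset.mem_range.1 hi) hir

theorem finrank_ker_one_sub_monomialOp [Finite ι] (hg : g.Injective) {R : Finset ι}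
    (hR : IsOrbitTransversal g R) [DecidableEq K] :
    Module.finrank K (LinearMap.ker (1 - monomialOp g a)) =
      {r ∈ R | orbitProd g a (Function.minimalPeriod g r) r = 1}.card := by
  classical
  set G := {r ∈ R | orbitProd g a (Function.minimalPeriod g r) r = 1}
  have hGR {r : ι} (hr : r ∈ G) : r ∈ R := (Finset.mem_filter.1 hr).1
  let eval : LinearMap.ker (1 - monomialOp g a) →ₗ[K] (G → K) :=
    LinearMap.pi fun r => Finsupp.lapply r.1 ∘ₗ Submodule.subtype _
  have eval_injective : Function.Injective eval := by
    intro v v' h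
    have heq : ∀ r ∈ R, v.1 r = v'.1 r := fun r hr => by
      by_cases hrG : r ∈ G
      · exact congrFun h ⟨r, hrG⟩
      · have hone : orbitProd g a (Function.minimalPeriod g r) r ≠ 1 :=
          fun hone => hrG (Finset.mem_filter.2 ⟨hr, hone⟩)
        rw [apply_eq_zero_of_mem_ker hg v.2 hone, apply_eq_zero_of_mem_ker hg v'.2 hone]
    refine Subtype.ext (Finsupp.ext fun w => ?_)
    obtain ⟨r, ⟨hr, i, rfl⟩, -⟩ := hR w
    rw [apply_iterate_of_mem_ker hg v.2, apply_iterate_of_mem_ker hg v'.2, heq r hr]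
  have eval_surjective : Function.Surjective eval := by
    rw [← LinearMap.range_eq_top, ← top_le_iff, ← (Pi.basisFun K G).span_eq, Submodule.span_le]
    rintro _ ⟨r, rfl⟩
    refine ⟨⟨_, sum_pow_single_mem_ker (Finset.mem_filter.1 r.2).2⟩, funext fun s => ?_⟩
    refine (sum_pow_single_apply hg hR (hGR r.2) (hGR s.2)).trans ?_
    rw [Pi.basisFun_apply, Pi.single_apply, Finsupp.single_apply]
    simp only [Subtype.ext_iff, eq_comm]
  rw [(LinearEquiv.ofBijective eval ⟨eval_injective, eval_surjective⟩).finrank_eq,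
    Module.finrank_fintype_fun_eq_card, Fintype.card_coe]

end Monomial

section ShiftRelations

variable {K : Type*} [Field K] {W : Type*} [AddCommGroup W] [Module K W]

theorem mem_ker_one_sub_iff {T : Module.End K W} {v : W} :
    v ∈ LinearMap.ker (1 - T) ↔ T v = v := by
  rw [LinearMap.mem_ker, LinearMap.sub_apply, Module.End.one_apply, sub_eq_zero, eq_comm]

theorem sub_pow_apply_mem_range (T : Module.End K W) (i : ℕ) (v : W) :
    v - (T ^ i) v ∈ LinearMap.range (1 - T) := by
  refine ⟨(∑ j ∈ Finset.range i, T ^ j) v, ?_⟩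
  rw [← Module.End.mul_apply, mul_neg_geom_sum, LinearMap.sub_apply, Module.End.one_apply]

theorem pow_apply_of_mem_ker {T : Module.End K W} {v : W} (hv : v ∈ LinearMap.ker (1 - T)) (i : ℕ) :
    (T ^ i) v = v := by
  rw [Module.End.pow_apply]
  exact Function.iterate_fixed (mem_ker_one_sub_iff.1 hv) i

theorem sum_pow_apply_of_mem_ker {T : Module.End K W} {v : W} (hv : v ∈ LinearMap.ker (1 - T))
    (L : ℕ) : ∑ i ∈ Finset.range L, (T ^ i) v = (L : K) • v := by
  simp only [pow_apply_of_mem_ker hv, Finset.sum_const, Finset.card_range, Nat.cast_smul_eq_nsmul]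

theorem sum_pow_apply_mem_ker {T : Module.End K W} {L : ℕ} (hT : T ^ L = 1) (v : W) :
    ∑ i ∈ Finset.range L, (T ^ i) v ∈ LinearMap.ker (1 - T) := by
  rw [← LinearMap.sum_apply, LinearMap.mem_ker, ← Module.End.mul_apply, mul_neg_geom_sum, hT,
    sub_self, LinearMap.zero_apply]

theorem disjoint_ker_range_one_sub {T : Module.End K W} {L : ℕ} (hT : T ^ L = 1)
    (hL : (L : K) ≠ 0) : Disjoint (LinearMap.ker (1 - T)) (LinearMap.range (1 - T)) := by
  rw [Submodule.disjoint_def]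
  rintro _ hu ⟨w, rfl⟩
  set u := (1 - T) w with hu_def
  have hsum_zero : ∑ i ∈ Finset.range L, (T ^ i) u = 0 := by
    rw [← LinearMap.sum_apply, hu_def, ← Module.End.mul_apply, geom_sum_mul_neg, hT, sub_self,
      LinearMap.zero_apply]
  exact (smul_eq_zero_iff_right hL).1 ((sum_pow_apply_of_mem_ker hu L).symm.trans hsum_zero)

variable {m : ℕ} {c : ℕ → Module.End K W} {X : Module.End K W}

theorem one_sub_mul_sum (h0 : c 0 = 1) (hX : ∀ t < m, c t * X = c m * c (t + 1)) :
    (1 - c m) * ∑ t ∈ Finset.range (m + 1), c t = (∑ t ∈ Finset.range m, c t) * (1 - X) := by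
  have hshift : c m * ∑ t ∈ Finset.range m, c (t + 1) = (∑ t ∈ Finset.range m, c t) * X := by
    rw [Finset.mul_sum, Finset.sum_mul]
    exact Finset.sum_congr rfl fun t ht => (hX t (Finset.mem_range.1 ht)).symm
  rw [sub_mul, one_mul, mul_sub, mul_one]
  nth_rw 2 [Finset.sum_range_succ']
  rw [Finset.sum_range_succ, mul_add, hshift, h0, mul_one, add_sub_add_right_eq_sub]

theorem pow_mul_eq_pow (h0 : c 0 = 1) (hX : ∀ t < m, c t * X = c m * c (t + 1)) {t : ℕ}
    (ht : t ≤ m) : c m ^ t * c t = X ^ t := by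
  induction t with
  | zero => rw [h0, pow_zero, pow_zero, one_mul]
  | succ t ih =>
    rw [pow_succ, mul_assoc, ← hX t ht, ← mul_assoc, ih (Nat.le_of_succ_le ht), pow_succ]

theorem sub_pow_mem_range (h0 : c 0 = 1) (hX : ∀ t < m, c t * X = c m * c (t + 1)) {t : ℕ}
    (ht : t ≤ m) (v : W) : c t v - (X ^ t) v ∈ LinearMap.range (1 - c m) := by
  rw [← pow_mul_eq_pow h0 hX ht, Module.End.mul_apply]
  exact sub_pow_apply_mem_range _ _ _

theorem ker_sum_le (h0 : c 0 = 1) (hX : ∀ t < m, c t * X = c m * c (t + 1))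
    (hinj : Function.Injective (∑ t ∈ Finset.range m, c t : Module.End K W)) :
    LinearMap.ker (∑ t ∈ Finset.range (m + 1), c t) ≤ LinearMap.ker (1 - X) := by
  intro v hv
  rw [LinearMap.mem_ker] at hv ⊢
  refine hinj ?_
  rw [← Module.End.mul_apply, ← one_sub_mul_sum h0 hX, Module.End.mul_apply, hv, map_zero, map_zero]

theorem map_sum_ker_le (h0 : c 0 = 1) (hX : ∀ t < m, c t * X = c m * c (t + 1)) :
    (LinearMap.ker (1 - X)).map (∑ t ∈ Finset.range (m + 1), c t) ≤ LinearMap.ker (1 - c m) := by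
  rintro _ ⟨v, hv, rfl⟩
  rw [LinearMap.mem_ker, ← Module.End.mul_apply, one_sub_mul_sum h0 hX, Module.End.mul_apply,
    LinearMap.mem_ker.1 hv, map_zero]

theorem ker_sup_range_eq_top [FiniteDimensional K W] (h0 : c 0 = 1)
    (hX : ∀ t < m, c t * X = c m * c (t + 1)) (hXm : X ^ m = 1)
    (hinj : Function.Injective (∑ t ∈ Finset.range m, c t : Module.End K W)) :
    LinearMap.ker (1 - X) ⊔ LinearMap.range (1 - c m) = ⊤ := by
  refine eq_top_iff.2 fun w _ => ?_
  obtain ⟨v, rfl⟩ := LinearMap.injective_iff_surjective.1 hinj w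
  refine Submodule.mem_sup.2 ⟨_, sum_pow_apply_mem_ker hXm v, _, ?_, add_sub_cancel _ _⟩
  rw [LinearMap.sum_apply, ← Finset.sum_sub_distrib]
  exact Submodule.sum_mem _ fun t ht => sub_pow_mem_range h0 hX (Finset.mem_range.1 ht).le v

theorem map_sum_ker_eq [FiniteDimensional K W] (h0 : c 0 = 1)
    (hX : ∀ t < m, c t * X = c m * c (t + 1)) (hXm : X ^ m = 1) (hcm : c m ^ (m + 1) = 1)
    (hK : ((m + 1 : ℕ) : K) ≠ 0)
    (hinj : Function.Injective (∑ t ∈ Finset.range m, c t : Module.End K W)) :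
    (LinearMap.ker (1 - X)).map (∑ t ∈ Finset.range (m + 1), c t) = LinearMap.ker (1 - c m) := by
  refine le_antisymm (map_sum_ker_le h0 hX) fun u hu => ?_
  obtain ⟨v, hv, r, hr, hvr⟩ := Submodule.mem_sup.1
    ((ker_sup_range_eq_top h0 hX hXm hinj).ge (Submodule.mem_top (x := u)))
  have hsum_mem : (∑ t ∈ Finset.range (m + 1), c t) v ∈ LinearMap.ker (1 - c m) :=
    map_sum_ker_le h0 hX (Submodule.mem_map_of_mem hv)
  have hsum_sub : (∑ t ∈ Finset.range (m + 1), c t) v - ((m + 1 : ℕ) : K) • v ∈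
      LinearMap.range (1 - c m) := by
    rw [← sum_pow_apply_of_mem_ker hv, LinearMap.sum_apply, ← Finset.sum_sub_distrib]
    exact Submodule.sum_mem _ fun t ht =>
      sub_pow_mem_range h0 hX (Finset.mem_range_succ_iff.1 ht) v
  have heq : (∑ t ∈ Finset.range (m + 1), c t) v = ((m + 1 : ℕ) : K) • u := by
    refine sub_eq_zero.1 (Submodule.disjoint_def.1 (disjoint_ker_range_one_sub hcm hK) _
      (sub_mem hsum_mem (Submodule.smul_mem _ _ hu)) ?_)
    rw [← hvr, smul_add, ← sub_sub]
    exact sub_mem hsum_sub (Submodule.smul_mem _ _ hr)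
  exact (Submodule.smul_mem_iff _ hK).1 (heq ▸ Submodule.mem_map_of_mem hv)

theorem finrank_ker_sum_add [FiniteDimensional K W] (h0 : c 0 = 1)
    (hX : ∀ t < m, c t * X = c m * c (t + 1)) (hXm : X ^ m = 1) (hcm : c m ^ (m + 1) = 1)
    (hK : ((m + 1 : ℕ) : K) ≠ 0)
    (hinj : Function.Injective (∑ t ∈ Finset.range m, c t : Module.End K W)) :
    Module.finrank K (LinearMap.ker (∑ t ∈ Finset.range (m + 1), c t)) +
      Module.finrank K (LinearMap.ker (1 - c m)) = Module.finrank K (LinearMap.ker (1 - X)) := by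
  have hrank := ((∑ t ∈ Finset.range (m + 1), c t).domRestrict
    (LinearMap.ker (1 - X))).finrank_range_add_finrank_ker
  rw [LinearMap.range_domRestrict, map_sum_ker_eq h0 hX hXm hcm hK hinj, LinearMap.ker_domRestrict,
    (Submodule.comapSubtypeEquivOfLe (ker_sum_le h0 hX hinj)).finrank_eq] at hrank
  rw [← hrank, add_comm]

end ShiftRelations

section Degrees

variable {n : ℕ}

theorem wordDegree_rotate (w : List (Fin n)) (i : ℕ) : wordDegree (w.rotate i) = wordDegree w :=
  funext fun j => (List.rotate_perm w i).count_eq j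

theorem wordDegree_append (u v : List (Fin n)) :
    wordDegree (u ++ v) = wordDegree u + wordDegree v :=
  funext fun _ => List.count_append

theorem wordDegree_cons (a : Fin n) (v : List (Fin n)) :
    wordDegree (a :: v) = e a + wordDegree v := by
  funext j
  rcases eq_or_ne j a with rfl | h
  · simp [wordDegree, e, Nat.add_comm]
  · simp [wordDegree, e, h, List.count_cons_of_ne h.symm]

theorem wordDegree_wordPow (u : List (Fin n)) (k : ℕ) :
    wordDegree (wordPow u k) = k • wordDegree u := by
  induction k with
  | zero => simp [wordPow_zero, wordDegree, funext_iff]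
  | succ k ih => rw [wordPow_succ, wordDegree_append, ih, succ_nsmul']

theorem size_wordDegree (w : List (Fin n)) : size (wordDegree w) = w.length := by
  have := Multiset.sum_count_eq_card (s := Finset.univ) (m := (w : Multiset (Fin n))) (by simp)
  simpa [size, wordDegree] using this

/-- The finite set of words of degree `m`. -/
def words (m : Fin n → ℕ) : Finset (List (Fin n)) :=
  Set.Finite.toFinset (s := {w | wordDegree w = m}) <|
    (List.finite_length_eq (Fin n) (size m)).subset fun w hw => by
      rw [← show wordDegree w = m from hw, size_wordDegree]
      rfl

@[simp] theorem mem_words {m : Fin n → ℕ} {w : List (Fin n)} : w ∈ words m ↔ wordDegree w = m := by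
  simp [words]

theorem length_of_mem_words {m : Fin n → ℕ} {w : List (Fin n)} (hw : w ∈ words m) :
    w.length = size m := by
  rw [← mem_words.1 hw, size_wordDegree]

theorem ne_nil_of_mem_words {m : Fin n → ℕ} (hm : 0 < size m) {w : List (Fin n)}
    (hw : w ∈ words m) : w ≠ [] :=
  List.ne_nil_of_length_pos (by rwa [length_of_mem_words hw])

theorem gcdVec_dvd (m : Fin n → ℕ) (i : Fin n) : gcdVec m ∣ m i :=
  Finset.gcd_dvd (Finset.mem_univ i)

theorem gcdVec_pos {m : Fin n → ℕ} (hm : 0 < size m) : 0 < gcdVec m := by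
  obtain ⟨i, -, hi⟩ : ∃ i ∈ Finset.univ, 0 < m i := Finset.sum_pos_iff.1 hm
  exact Nat.pos_of_dvd_of_pos (gcdVec_dvd m i) hi

theorem nsmul_divVec {m : Fin n → ℕ} {k : ℕ} (hk : k ∣ gcdVec m) : k • divVec m k = m :=
  funext fun i => Nat.mul_div_cancel' (hk.trans (gcdVec_dvd m i))

theorem divVec_nsmul (m : Fin n → ℕ) {k : ℕ} (hk : 0 < k) : divVec (k • m) k = m :=
  funext fun i => Nat.mul_div_cancel_left (m i) hk

theorem exponent_nsmul_wordDegree_take (w : List (Fin n)) :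
    exponent w • wordDegree (w.take (rotPeriod w)) = wordDegree w := by
  rw [← wordDegree_wordPow, wordPow_take_rotPeriod]

theorem wordDegree_take_rotPeriod {w : List (Fin n)} (hw : w ≠ []) :
    wordDegree (w.take (rotPeriod w)) = divVec (wordDegree w) (exponent w) := by
  rw [← exponent_nsmul_wordDegree_take w, divVec_nsmul _ (exponent_pos hw)]

theorem exponent_dvd_gcdVec {m : Fin n → ℕ} {w : List (Fin n)} (hw : w ∈ words m) :
    exponent w ∣ gcdVec m := by
  rw [← mem_words.1 hw, ← exponent_nsmul_wordDegree_take w]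
  exact Finset.dvd_gcd fun i _ => dvd_mul_right _ _

end Degrees

section Counting

variable {n : ℕ} {m : Fin n → ℕ}

open Classical in
theorem card_necklaces_of_exponent_eq (hm : 0 < size m) {k : ℕ} (hk : k ∣ gcdVec m) :
    {w ∈ words m | IsNecklace w ∧ exponent w = k}.card = lyndonCount (divVec m k) := by
  have hk0 : 0 < k := Nat.pos_of_dvd_of_pos hk (gcdVec_pos hm)
  rw [lyndonCount, ← Set.ncard_coe_finset, eq_comm]
  refine Set.ncard_congr (fun u _ => wordPow u k) ?_ ?_ ?_
  · rintro u ⟨hu, hum⟩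
    obtain ⟨-, hneck, hexp⟩ := isLyndon_iff_isNecklace.1 hu
    simp only [Finset.coe_filter, mem_words, Set.mem_ofPred_eq]
    refine ⟨by rw [wordDegree_wordPow, hum, nsmul_divVec hk],
      (isNecklace_wordPow_iff u hk0).2 hneck,
      by rw [exponent_wordPow u hk0, hexp, mul_one]⟩
  · rintro u v ⟨-, hu⟩ ⟨-, hv⟩ huv
    refine (wordPow_inj ?_ hk0).1 huv
    rw [← size_wordDegree u, ← size_wordDegree v, hu, hv]
  · intro w hw
    simp only [Finset.coe_filter, Set.mem_ofPred_eq] at hw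
    obtain ⟨hwm, hneck, rfl⟩ := hw
    have hw0 : w ≠ [] := ne_nil_of_mem_words hm hwm
    have hpow := wordPow_take_rotPeriod w
    have htake0 : w.take (rotPeriod w) ≠ [] := by
      intro h
      rw [h] at hpow
      exact hw0 (by rw [← hpow]; simp [wordPow])
    refine ⟨w.take (rotPeriod w), ⟨isLyndon_iff_isNecklace.2 ⟨htake0, ?_,
      exponent_take_rotPeriod hw0⟩, ?_⟩, hpow⟩
    · rw [← isNecklace_wordPow_iff _ hk0, hpow]
      exact hneck
    · rw [← mem_words.1 hwm, wordDegree_take_rotPeriod hw0]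

open Classical in
theorem sum_necklaces_exponent (hm : 0 < size m) (φ : ℕ → ℕ) :
    ∑ w ∈ words m with IsNecklace w, φ (exponent w) =
      ∑ k ∈ (gcdVec m).divisors, φ k * lyndonCount (divVec m k) := by
  rw [← Finset.sum_fiberwise_of_maps_to (t := (gcdVec m).divisors) (g := exponent)]
  · refine Finset.sum_congr rfl fun k hk => ?_
    rw [← card_necklaces_of_exponent_eq hm (Nat.dvd_of_mem_divisors hk), Finset.filter_filter,
      mul_comm, ← smul_eq_mul, ← Finset.sum_const]
    exact Finset.sum_congr rfl fun w hw => by rw [(Finset.mem_filter.1 hw).2.2]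
  · intro w hw
    exact Nat.mem_divisors.2
      ⟨exponent_dvd_gcdVec (Finset.mem_filter.1 hw).1, (gcdVec_pos hm).ne'⟩

/-- The self-map of the words of degree `m` induced by a degree preserving map of words. -/
def wordMap (m : Fin n → ℕ) (g : List (Fin n) → List (Fin n))
    (hg : ∀ w, wordDegree (g w) = wordDegree w) (w : words m) : words m :=
  ⟨g w, by rw [mem_words, hg, mem_words.1 w.2]⟩

section WordMap

variable {g : List (Fin n) → List (Fin n)} {hg : ∀ w, wordDegree (g w) = wordDegree w}

theorem coe_wordMap_iterate (k : ℕ) (w : words m) : ((wordMap m g hg)^[k] w).1 = g^[k] w.1 :=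
  (Function.Semiconj.iterate_right (f := Subtype.val) (fun _ => rfl) k).eq w

theorem minimalPeriod_wordMap (w : words m) :
    Function.minimalPeriod (wordMap m g hg) w = Function.minimalPeriod g w.1 :=
  Function.minimalPeriod_eq_minimalPeriod_iff.2 fun k => by
    rw [Function.IsPeriodicPt, Function.IsPeriodicPt, Function.IsFixedPt, Function.IsFixedPt,
      ← coe_wordMap_iterate k w, Subtype.ext_iff]

theorem wordMap_injective (h : Function.Injective g) : Function.Injective (wordMap m g hg) :=
  fun _ _ huv => Subtype.ext (h (congrArg Subtype.val huv))

end WordMap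

/-- The cyclic rotation `w₁⋯w_r ↦ w₂⋯w_r w₁` on the words of degree `m`. -/
def rotWord (m : Fin n → ℕ) : words m → words m :=
  wordMap m (fun w => w.rotate 1) fun w => wordDegree_rotate w 1

theorem coe_rotWord_iterate (k : ℕ) (w : words m) :
    ((rotWord m)^[k] w).1 = w.1.rotate k := by
  rw [rotWord, coe_wordMap_iterate, rotate_one_iterate]

theorem minimalPeriod_rotWord (w : words m) :
    Function.minimalPeriod (rotWord m) w = rotPeriod w.1 :=
  minimalPeriod_wordMap w

theorem rotWord_injective : Function.Injective (rotWord m) :=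
  wordMap_injective (List.rotate_injective 1)

open Classical in
theorem isOrbitTransversal_necklaces (m : Fin n → ℕ) :
    IsOrbitTransversal (rotWord m) {w : words m | IsNecklace w.1} := by
  intro w
  obtain ⟨i, hi⟩ := exists_isNecklace_rotate w.1
  obtain ⟨j, hj⟩ : w.1.rotate i ~r w.1 := List.IsRotated.symm ⟨i, rfl⟩
  refine ⟨(rotWord m)^[i] w, ⟨?_, j, Subtype.ext ?_⟩, ?_⟩
  · simpa [coe_rotWord_iterate] using hi
  · rw [coe_rotWord_iterate, coe_rotWord_iterate, hj]
  · rintro v ⟨hv, k, rfl⟩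
    refine Subtype.ext ((Finset.mem_filter.1 hv).2.eq_of_isRotated ?_ ⟨k + i, ?_⟩)
    · rw [coe_rotWord_iterate]
      exact hi
    · rw [coe_rotWord_iterate, coe_rotWord_iterate, List.rotate_rotate]

theorem card_words (hm : 0 < size m) :
    (words m).card =
      ∑ k ∈ (gcdVec m).divisors, size m / k * lyndonCount (divVec m k) := by
  classical
  rw [← sum_necklaces_exponent hm fun k => size m / k, ← Fintype.card_coe,
    card_eq_sum_minimalPeriod rotWord_injective (isOrbitTransversal_necklaces m),
    Finset.sum_filter, Finset.sum_filter, ← Finset.sum_coe_sort (words m)]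
  refine Finset.sum_congr rfl fun w _ => ?_
  have hw0 := ne_nil_of_mem_words hm w.2
  rw [minimalPeriod_rotWord, ← length_of_mem_words w.2, ← exponent_mul_rotPeriod w.1,
    Nat.mul_div_cancel_left _ (exponent_pos hw0)]

end Counting

section Scalars

variable {n : ℕ}

theorem sub_e_self (m : Fin n → ℕ) (a : Fin n) : (m - e a) a = m a - 1 := by simp [e]

theorem sub_e_of_ne (m : Fin n → ℕ) {a b : Fin n} (h : b ≠ a) : (m - e a) b = m b := by
  simp [e, h]

theorem e_le {m : Fin n → ℕ} {a : Fin n} (h : 0 < m a) : e a ≤ m := by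
  intro b
  rcases eq_or_ne b a with rfl | hb
  · rwa [e, Pi.single_eq_same]
  · simp [e, hb]

theorem sub_e_add_e {m : Fin n → ℕ} {a : Fin n} (h : 0 < m a) : m - e a + e a = m :=
  tsub_add_cancel_of_le (e_le h)

theorem size_add (l m : Fin n → ℕ) : size (l + m) = size l + size m :=
  Finset.sum_add_distrib

theorem size_e (a : Fin n) : size (e a) = 1 := by simp [size, e]

theorem size_sub_e {m : Fin n → ℕ} {a : Fin n} (h : 0 < m a) : size (m - e a) = size m - 1 := by
  rw [← Nat.add_sub_cancel (size (m - e a)) 1, ← size_e a, ← size_add, sub_e_add_e h]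

theorem N_dvd_mul_pred (m : Fin n → ℕ) (a : Fin n) : N m ∣ m a * (m a - 1) :=
  (Nat.gcd_dvd_left _ _).trans
    (Finset.gcd_dvd (f := fun i => m i * (m i - 1)) (Finset.mem_univ a))

theorem N_dvd_mul_of_ne (m : Fin n → ℕ) {a b : Fin n} (h : a ≠ b) : N m ∣ m a * m b := by
  wlog hab : a < b generalizing a b
  · rw [Nat.mul_comm]
    exact this h.symm (lt_of_le_of_ne (not_lt.1 hab) h.symm)
  exact (Nat.gcd_dvd_right _ _).trans
    (Finset.gcd_dvd (f := fun a : Fin n × Fin n => m a.1 * m a.2) (b := (a, b))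
      (by simpa using hab))

theorem N_dvd_sub_e_mul (m : Fin n → ℕ) (a b : Fin n) : N m ∣ (m - e a) b * m a := by
  rcases eq_or_ne b a with rfl | h
  · rw [sub_e_self, Nat.mul_comm]
    exact N_dvd_mul_pred m b
  · rw [sub_e_of_ne m h]
    exact N_dvd_mul_of_ne m h

theorem dvd_N {m : Fin n → ℕ} {r : ℕ} (h : ∀ a b, r ∣ (m - e a) b * m a) : r ∣ N m := by
  refine Nat.dvd_gcd (Finset.dvd_gcd fun a _ => ?_) (Finset.dvd_gcd fun a ha => ?_)
  · simpa only [sub_e_self, Nat.mul_comm] using h a a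
  · have hne := (Finset.mem_filter.1 ha).2.ne
    simpa only [sub_e_of_ne m hne] using h a.2 a.1

theorem dvd_N_of_dvd_gcdVec {m : Fin n → ℕ} {r : ℕ} (hr : r ∣ gcdVec m) : r ∣ N m :=
  dvd_N fun a _ => (hr.trans (gcdVec_dvd m a)).mul_left _

theorem dvd_N_of_dvd_gcdVec_sub {m : Fin n → ℕ} {i : Fin n} {r : ℕ}
    (hr : r ∣ gcdVec (m - e i)) : r ∣ N m := by
  have hri (b : Fin n) : r ∣ (m - e i) b := hr.trans (gcdVec_dvd _ b)
  refine dvd_N fun a b => ?_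
  rcases eq_or_ne a i with rfl | ha
  · exact (hri b).mul_right _
  · rw [← sub_e_of_ne m ha]
    exact (hri a).mul_left _

theorem N_pos {m : Fin n → ℕ} (hm : 2 ≤ size m) : 0 < N m := by
  obtain ⟨a, -, ha⟩ : ∃ a ∈ Finset.univ, 0 < m a := Finset.sum_pos_iff.1 (zero_lt_two.trans_le hm)
  obtain ⟨b, -, hb⟩ : ∃ b ∈ Finset.univ, 0 < (m - e a) b := by
    refine Finset.sum_pos_iff.1 (show 0 < size (m - e a) from ?_)
    rw [size_sub_e ha]
    omega
  exact Nat.pos_of_dvd_of_pos (N_dvd_sub_e_mul m a b) (Nat.mul_pos hb ha)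

theorem prod_prod_eq_prod_diag_mul_prod_pairs {M : Type*} [CommMonoid M] (f : Fin n → Fin n → M) :
    ∏ a, ∏ b, f a b =
      (∏ a, f a a) * ∏ a : Fin n × Fin n with a.1 < a.2, f a.1 a.2 * f a.2 a.1 := by
  rw [Finset.prod_finset_product' _ Finset.univ Finset.Ioi (by simp)
      (f := fun i j => f i j * f j i),
    Finset.prod_congr rfl fun i _ => Finset.prod_congr rfl fun j _ => mul_comm (f i j) (f j i),
    Finset.prod_prod_Ioi_mul_eq_prod_prod_off_diag, ← Finset.prod_mul_distrib, Finset.prod_comm]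
  exact Finset.prod_congr rfl fun a _ => Fintype.prod_eq_mul_prod_compl a fun b => f b a

variable {K : Type*} [Field K] (q : Fin n → Fin n → K)

theorem evalAt_p (a b : Fin n) : evalAt q (p a b) = q a b := by
  simp [evalAt, p]

theorem evalAt_Q (m : Fin n → ℕ) :
    evalAt q (Q m) = ∏ a, ∏ b, q a b ^ ((m - e a) b * m a / N m) := by
  have hp (a b : Fin n) : MvPolynomial.aeval (fun a : Fin n × Fin n => q a.1 a.2) (p a b) = q a b :=
    evalAt_p q a b
  simp only [prod_prod_eq_prod_diag_mul_prod_pairs, Q, evalAt, map_mul, map_prod, map_pow, hp]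
  congr 1
  · refine Finset.prod_congr rfl fun a _ => ?_
    rw [sub_e_self, Nat.mul_comm]
  · refine Finset.prod_congr rfl fun a ha => ?_
    have hne := (Finset.mem_filter.1 ha).2.ne
    rw [sub_e_of_ne m hne, sub_e_of_ne m hne.symm, Nat.mul_comm (m a.2), mul_pow]

theorem evalAt_Q_pow {m : Fin n → ℕ} (hm : 2 ≤ size m) {r : ℕ} (hr : r ∣ N m) :
    evalAt q (Q m) ^ (N m / r) = ∏ a, ∏ b, q a b ^ ((m - e a) b * m a / r) := by
  simp only [evalAt_Q, ← Finset.prod_pow, ← pow_mul]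
  refine Finset.prod_congr rfl fun a _ => Finset.prod_congr rfl fun b _ => ?_
  rw [Nat.div_mul_div_comm (N_dvd_sub_e_mul m a b) hr, Nat.mul_comm (N m) r,
    Nat.mul_div_mul_right _ _ (N_pos hm)]

/-- The scalar obtained by moving a letter `a` past all other letters of a word of degree `m`. -/
def rowProd (m : Fin n → ℕ) (a : Fin n) : K := ∏ b, q a b ^ (m - e a) b

theorem prod_rowProd_pow {m : Fin n → ℕ} (hm : 2 ≤ size m) {r : ℕ} (hr : r ∣ gcdVec m) :
    ∏ a, rowProd q m a ^ (m a / r) = evalAt q (Q m) ^ (N m / r) := by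
  simp only [evalAt_Q_pow q hm (dvd_N_of_dvd_gcdVec hr), rowProd, ← Finset.prod_pow, ← pow_mul]
  refine Finset.prod_congr rfl fun a _ => Finset.prod_congr rfl fun b _ => ?_
  rw [Nat.mul_div_assoc _ (hr.trans (gcdVec_dvd m a))]

theorem prod_mul_rowProd_pow {m : Fin n → ℕ} (hm : 2 ≤ size m) {i : Fin n} (hi : 0 < m i)
    {r : ℕ} (hr : r ∣ gcdVec (m - e i)) :
    ∏ a, (q i a * rowProd q m a) ^ ((m - e i) a / r) = evalAt q (Q m) ^ (N m / r) := by
  have hri (b : Fin n) : r ∣ (m - e i) b := hr.trans (gcdVec_dvd _ b)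
  simp only [evalAt_Q_pow q hm (dvd_N_of_dvd_gcdVec_sub hr), mul_pow, Finset.prod_mul_distrib]
  rw [← Finset.mul_prod_erase _ (fun a => rowProd q m a ^ _) (Finset.mem_univ i),
    ← Finset.mul_prod_erase _ (fun a => ∏ b, q a b ^ _) (Finset.mem_univ i), ← mul_assoc]
  congr 1
  · rw [rowProd, ← Finset.prod_pow, ← Finset.prod_mul_distrib]
    refine Finset.prod_congr rfl fun b _ => ?_
    have hmi : m i = (m - e i) i + 1 := by rw [sub_e_self]; omega
    rw [← pow_mul, ← pow_add, hmi, mul_add, mul_one, Nat.add_div_of_dvd_left (hri b),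
      Nat.mul_div_assoc _ (hri i), add_comm]
  · refine Finset.prod_congr rfl fun a ha => ?_
    rw [rowProd, ← Finset.prod_pow]
    refine Finset.prod_congr rfl fun b _ => ?_
    rw [← pow_mul, ← Nat.mul_div_assoc _ (hri a), sub_e_of_ne m (Finset.ne_of_mem_erase ha)]

end Scalars

section FirstLetter

variable {n : ℕ} {m : Fin n → ℕ}

theorem cons_mem_words_iff {a : Fin n} {v : List (Fin n)} :
    a :: v ∈ words m ↔ 0 < m a ∧ v ∈ words (m - e a) := by
  simp only [mem_words, wordDegree_cons]
  constructor
  · rintro rfl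
    exact ⟨by simp [e], (add_tsub_cancel_left _ _).symm⟩
  · rintro ⟨ha, hv⟩
    rw [hv, add_comm, sub_e_add_e ha]

theorem append_singleton_mem_words_iff {a : Fin n} {v : List (Fin n)} :
    v ++ [a] ∈ words m ↔ 0 < m a ∧ v ∈ words (m - e a) := by
  rw [← cons_mem_words_iff, mem_words, mem_words, wordDegree_append, add_comm,
    ← wordDegree_append, List.singleton_append]

theorem exists_eq_cons_of_mem_words (hm : 0 < size m) {w : List (Fin n)} (hw : w ∈ words m) :
    ∃ a v, w = a :: v ∧ 0 < m a ∧ v ∈ words (m - e a) := by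
  obtain ⟨a, v, rfl⟩ := List.exists_cons_of_ne_nil (ne_nil_of_mem_words hm hw)
  exact ⟨a, v, rfl, cons_mem_words_iff.1 hw⟩

theorem exists_eq_cons_cons_of_mem_words (hm : 2 ≤ size m) {w : List (Fin n)} (hw : w ∈ words m) :
    ∃ a b v, w = a :: b :: v ∧ v.length + 2 = size m := by
  obtain ⟨a, v, rfl, ha, hv⟩ := exists_eq_cons_of_mem_words (by omega) hw
  obtain ⟨b, v, rfl, -⟩ := exists_eq_cons_of_mem_words (by rw [size_sub_e ha]; omega) hv
  exact ⟨a, b, v, rfl, length_of_mem_words hw⟩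

theorem sum_words_eq_sum_cons {M : Type*} [AddCommMonoid M] (hm : 0 < size m)
    (f : List (Fin n) → M) :
    ∑ w ∈ words m, f w = ∑ a : Fin n with 0 < m a, ∑ v ∈ words (m - e a), f (a :: v) := by
  rw [Finset.sum_sigma', eq_comm]
  refine Finset.sum_nbij (fun x => x.1 :: x.2) ?_ ?_ ?_ fun _ _ => rfl
  · rintro ⟨a, v⟩ h
    simpa [-mem_words, cons_mem_words_iff] using h
  · rintro ⟨a, v⟩ - ⟨b, u⟩ - h
    obtain ⟨rfl, rfl⟩ := List.cons.inj h
    rfl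
  · intro w hw
    obtain ⟨a, v, rfl, ha, hv⟩ := exists_eq_cons_of_mem_words hm hw
    exact ⟨⟨a, v⟩, by simpa using ⟨ha, mem_words.1 hv⟩, rfl⟩

/-- Cyclic rotation of all letters but the first. -/
def rotTail : List (Fin n) → List (Fin n)
  | [] => []
  | a :: v => a :: v.rotate 1

theorem rotTail_iterate_cons (a : Fin n) (v : List (Fin n)) (k : ℕ) :
    rotTail^[k] (a :: v) = a :: v.rotate k := by
  induction k with
  | zero => rw [List.rotate_zero, Function.iterate_zero_apply]
  | succ k ih => rw [Function.iterate_succ_apply', ih, rotTail, List.rotate_rotate]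

theorem wordDegree_rotTail (w : List (Fin n)) : wordDegree (rotTail w) = wordDegree w := by
  cases w with
  | nil => rfl
  | cons a v => rw [rotTail, wordDegree_cons, wordDegree_cons, wordDegree_rotate]

/-- The map `rotTail` on the words of degree `m`. -/
def rotTailWord (m : Fin n → ℕ) : words m → words m := wordMap m rotTail wordDegree_rotTail

theorem rotTailWord_injective : Function.Injective (rotTailWord m) :=
  wordMap_injective fun w v h => by
    cases w <;> cases v <;> simp_all [rotTail, (List.rotate_injective 1).eq_iff]

theorem minimalPeriod_rotTailWord (w : words m) :
    Function.minimalPeriod (rotTailWord m) w = rotPeriod w.1.tail := by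
  rw [rotTailWord, minimalPeriod_wordMap, rotPeriod, Function.minimalPeriod_eq_minimalPeriod_iff]
  intro k
  rcases w.1 with _ | ⟨a, v⟩
  · have hnil : Function.IsFixedPt rotTail ([] : List (Fin n)) := rfl
    have hrot : Function.IsFixedPt (fun l : List (Fin n) => l.rotate 1) [] := rfl
    exact iff_of_true (hnil.iterate k) (hrot.iterate k)
  · simp [Function.IsPeriodicPt, Function.IsFixedPt, rotTail_iterate_cons, rotate_one_iterate]

open Classical in
theorem isOrbitTransversal_necklace_tails (hm : 0 < size m) :
    IsOrbitTransversal (rotTailWord m) {w : words m | IsNecklace w.1.tail} := by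
  rintro ⟨w, hw⟩
  obtain ⟨a, v, rfl, -⟩ := exists_eq_cons_of_mem_words hm hw
  obtain ⟨i, hi⟩ := exists_isNecklace_rotate v
  obtain ⟨j, hj⟩ : v.rotate i ~r v := List.IsRotated.symm ⟨i, rfl⟩
  refine ⟨(rotTailWord m)^[i] ⟨a :: v, hw⟩, ⟨?_, j, Subtype.ext ?_⟩, ?_⟩
  · simpa [rotTailWord, coe_wordMap_iterate, rotTail_iterate_cons] using hi
  · simp only [rotTailWord, coe_wordMap_iterate, rotTail_iterate_cons, hj]
  · rintro ⟨u, hu⟩ ⟨hneck, k, hk⟩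
    obtain ⟨b, u, rfl, -⟩ := exists_eq_cons_of_mem_words hm hu
    have hcons := congrArg Subtype.val hk
    simp only [rotTailWord, coe_wordMap_iterate, rotTail_iterate_cons] at hcons
    obtain ⟨rfl, rfl⟩ := List.cons.inj hcons
    refine Subtype.ext ?_
    simp only [rotTailWord, coe_wordMap_iterate, rotTail_iterate_cons, List.rotate_rotate] at hi ⊢
    exact congrArg (b :: ·)
      (IsNecklace.eq_of_isRotated (Finset.mem_filter.1 hneck).2 hi ⟨k + i, rfl⟩)

end FirstLetter

section WordOperators

variable {n : ℕ} {m : Fin n → ℕ} {K : Type*} [Field K] (q : Fin n → Fin n → K)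

/-- The word in which the first letter of `w` is moved to the right by `t` places. -/
def moveFirst (t : ℕ) : List (Fin n) → List (Fin n)
  | [] => []
  | a :: v => v.take t ++ a :: v.drop t

theorem wordDegree_moveFirst (t : ℕ) (w : List (Fin n)) :
    wordDegree (moveFirst t w) = wordDegree w := by
  cases w with
  | nil => rfl
  | cons a v =>
    rw [moveFirst, wordDegree_append, wordDegree_cons, add_left_comm, ← wordDegree_append,
      List.take_append_drop, wordDegree_cons]

theorem moveFirst_append_singleton {t : ℕ} {w : List (Fin n)} (ht : t < w.length) (i : Fin n) :
    moveFirst t (w ++ [i]) = moveFirst t w ++ [i] := by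
  cases w with
  | nil => exact absurd ht (Nat.not_lt_zero t)
  | cons a v =>
    have htv : t ≤ v.length := Nat.lt_succ_iff.1 ht
    simp [moveFirst, List.take_append_of_le_length htv, List.drop_append_of_le_length htv]

/-- The map `moveFirst t` on the words of degree `m`. -/
def moveWord (m : Fin n → ℕ) (t : ℕ) : words m → words m :=
  wordMap m (moveFirst t) (wordDegree_moveFirst t)

/-- The scalar obtained by braiding the first letter of a word with the `t` following letters. -/
def moveCoef (t : ℕ) : List (Fin n) → K
  | [] => 1
  | a :: v => ((v.take t).map (q a)).prod

theorem moveCoef_append_singleton {t : ℕ} {w : List (Fin n)} (ht : t < w.length) (i : Fin n) :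
    moveCoef q t (w ++ [i]) = moveCoef q t w := by
  cases w with
  | nil => exact absurd ht (Nat.not_lt_zero t)
  | cons a v =>
    rw [List.cons_append, moveCoef, moveCoef, List.take_append_of_le_length (Nat.lt_succ_iff.1 ht)]

/-- The action of `σ_t ⋯ σ_1` on the span of the words of degree `m`. -/
def moveOp (m : Fin n → ℕ) (t : ℕ) : Module.End K (words m →₀ K) :=
  monomialOp (moveWord m t) fun w => moveCoef q t w.1

/-- The scalar in the action of `σ_{|m|-1} ⋯ σ_1` on a word of degree `m`. -/
def rotCoef (m : Fin n → ℕ) (w : List (Fin n)) : K := w.head?.elim 1 (rowProd q m)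

/-- The action of `σ_{|m|-1} ⋯ σ_2 σ_1²` on the span of the words of degree `m`. -/
def twistOp (m : Fin n → ℕ) : Module.End K (words m →₀ K) :=
  moveOp q m (size m - 1) * moveOp q m 1

/-- The scalar in the action of `twistOp` on a word of degree `m`. -/
def twistCoef (m : Fin n → ℕ) : List (Fin n) → K
  | [] => 1
  | a :: v => v.head?.elim 1 fun b => q a b * rowProd q m b

/-- The action of `S_{1,|m|-1}` on the span of the words of degree `m`. -/
def shuffleOp (m : Fin n → ℕ) : Module.End K (words m →₀ K) :=
  ∑ t ∈ Finset.range (size m), moveOp q m t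

theorem prod_map_eq_prod_pow {M : Type*} [CommMonoid M] (f : Fin n → M) (w : List (Fin n)) :
    (w.map f).prod = ∏ a, f a ^ wordDegree w a := by
  rw [Finset.prod_list_map_count]
  refine Finset.prod_subset (Finset.subset_univ _) fun a _ ha => ?_
  rw [List.count_eq_zero_of_not_mem (fun h => ha (List.mem_toFinset.2 h)), pow_zero]

theorem prod_head_rotate {M : Type*} [CommMonoid M] (f : Fin n → M) {w : List (Fin n)} {k : ℕ}
    (hk : k ≤ w.length) :
    ∏ j ∈ Finset.range k, (w.rotate j).head?.elim 1 f = ((w.take k).map f).prod := by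
  induction k with
  | zero => simp
  | succ k ih =>
    have hlt : k < w.length := hk
    rw [Finset.prod_range_succ, ih hlt.le, List.head?_rotate hlt,
      List.take_succ_eq_append_getElem hlt, List.map_append, List.prod_append,
      List.getElem?_eq_getElem hlt]
    simp

theorem prod_head_rotate_rotPeriod {M : Type*} [CommMonoid M] (f : Fin n → M) {w : List (Fin n)}
    (hw : w ≠ []) :
    ∏ j ∈ Finset.range (rotPeriod w), (w.rotate j).head?.elim 1 f =
      ∏ a, f a ^ (wordDegree w a / exponent w) := by
  rw [prod_head_rotate f (Nat.le_of_dvd (List.length_pos_iff.2 hw) (rotPeriod_dvd_length w)),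
    prod_map_eq_prod_pow, wordDegree_take_rotPeriod hw]
  rfl

theorem moveOp_zero : moveOp q m 0 = 1 := by
  rw [← monomialOp_id, moveOp]
  refine monomialOp_congr ?_
  rintro ⟨_ | ⟨a, v⟩, hw⟩ <;> exact ⟨Subtype.ext rfl, rfl⟩

theorem moveOp_size_sub_one (hm : 0 < size m) :
    moveOp q m (size m - 1) = monomialOp (rotWord m) fun w => rotCoef q m w.1 := by
  rw [moveOp]
  refine monomialOp_congr ?_
  rintro ⟨w, hw⟩
  obtain ⟨a, v, rfl, -, hv⟩ := exists_eq_cons_of_mem_words hm hw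
  have hlen : v.length ≤ size m - 1 := by rw [← length_of_mem_words hw, List.length_cons]; omega
  constructor
  · refine Subtype.ext ?_
    simp [moveWord, rotWord, wordMap, moveFirst, List.take_of_length_le hlen,
      List.drop_of_length_le hlen]
  · simp only [moveCoef, List.take_of_length_le hlen, prod_map_eq_prod_pow, mem_words.1 hv]
    rfl

theorem twistOp_eq (hm : 2 ≤ size m) :
    twistOp q m = monomialOp (rotTailWord m) fun w => twistCoef q m w.1 := by
  rw [twistOp, moveOp_size_sub_one q (by omega), moveOp, monomialOp_mul]
  refine monomialOp_congr ?_
  rintro ⟨w, hw⟩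
  obtain ⟨a, b, v, rfl, -⟩ := exists_eq_cons_cons_of_mem_words hm hw
  constructor
  · refine Subtype.ext ?_
    simp [rotWord, moveWord, rotTailWord, wordMap, moveFirst, rotTail]
  · simp [moveWord, wordMap, moveFirst, moveCoef, rotCoef, twistCoef, mul_comm]

theorem moveOp_mul_twistOp (hm : 2 ≤ size m) {t : ℕ} (ht : t < size m - 1) :
    moveOp q m t * twistOp q m = moveOp q m (size m - 1) * moveOp q m (t + 1) := by
  rw [twistOp_eq q hm, moveOp_size_sub_one q (by omega), moveOp, moveOp, monomialOp_mul,
    monomialOp_mul]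
  refine monomialOp_congr ?_
  rintro ⟨w, hw⟩
  obtain ⟨a, b, v, rfl, hlen⟩ := exists_eq_cons_cons_of_mem_words hm hw
  have htv : t ≤ v.length := by omega
  constructor
  · refine Subtype.ext ?_
    simp [rotWord, moveWord, rotTailWord, wordMap, moveFirst, rotTail,
      List.take_append_of_le_length htv, List.drop_append_of_le_length htv]
  · simp [rotTailWord, moveWord, wordMap, rotTail, moveFirst, moveCoef, twistCoef, rotCoef,
      List.take_append_of_le_length htv]
    ring

theorem orbitProd_rotWord (hm : 2 ≤ size m) (w : words m) :
    orbitProd (rotWord m) (fun w => rotCoef q m w.1) (Function.minimalPeriod (rotWord m) w) w =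
      evalAt q (Q m) ^ (N m / exponent w.1) := by
  simp only [minimalPeriod_rotWord, orbitProd, rotCoef, coe_rotWord_iterate]
  rw [prod_head_rotate_rotPeriod _ (ne_nil_of_mem_words (by omega) w.2), mem_words.1 w.2,
    prod_rowProd_pow q hm (exponent_dvd_gcdVec w.2)]

theorem orbitProd_rotTailWord (hm : 2 ≤ size m) (w : words m) :
    orbitProd (rotTailWord m) (fun w => twistCoef q m w.1)
        (Function.minimalPeriod (rotTailWord m) w) w =
      evalAt q (Q m) ^ (N m / exponent w.1.tail) := by
  obtain ⟨w, hw⟩ := w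
  obtain ⟨a, v, rfl, ha, hv⟩ := exists_eq_cons_of_mem_words (by omega) hw
  rw [minimalPeriod_rotTailWord, orbitProd]
  simp only [rotTailWord, coe_wordMap_iterate, rotTail_iterate_cons, twistCoef, List.tail_cons]
  have hv0 : v ≠ [] := ne_nil_of_mem_words (by rw [size_sub_e ha]; omega) hv
  rw [prod_head_rotate_rotPeriod _ hv0, mem_words.1 hv,
    prod_mul_rowProd_pow q hm ha (exponent_dvd_gcdVec hv)]

end WordOperators

section ShuffleKernelDimension

variable {n : ℕ} {m : Fin n → ℕ} {K : Type*} [Field K] (q : Fin n → Fin n → K)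

theorem monomialOp_pow_eq_smul_one {ι : Type*} {g : ι → ι} {a : ι → K} {L : ℕ} {c : K}
    (h : ∀ w, ∃ k, Function.minimalPeriod g w * k = L ∧
      orbitProd g a (Function.minimalPeriod g w) w ^ k = c) :
    monomialOp g a ^ L = c • 1 := by
  refine Finsupp.lhom_ext fun w x => ?_
  obtain ⟨k, rfl, rfl⟩ := h w
  rw [monomialOp_pow, monomialOp_single, orbitProd_minimalPeriod_mul,
    (Function.isPeriodicPt_minimalPeriod g w).mul_const k |>.eq, LinearMap.smul_apply,
    Module.End.one_apply, Finsupp.smul_single, smul_eq_mul]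

theorem moveOp_size_sub_one_pow (hm : 2 ≤ size m) :
    moveOp q m (size m - 1) ^ size m = evalAt q (Q m) ^ N m • 1 := by
  rw [moveOp_size_sub_one q (by omega)]
  refine monomialOp_pow_eq_smul_one fun w => ⟨exponent w.1, ?_, ?_⟩
  · rw [minimalPeriod_rotWord, mul_comm, exponent_mul_rotPeriod, length_of_mem_words w.2]
  · rw [orbitProd_rotWord q hm, ← pow_mul,
      Nat.div_mul_cancel (dvd_N_of_dvd_gcdVec (exponent_dvd_gcdVec w.2))]

theorem twistOp_pow (hm : 2 ≤ size m) :
    twistOp q m ^ (size m - 1) = evalAt q (Q m) ^ N m • 1 := by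
  rw [twistOp_eq q hm]
  refine monomialOp_pow_eq_smul_one fun w => ⟨exponent w.1.tail, ?_, ?_⟩
  · rw [minimalPeriod_rotTailWord, mul_comm, exponent_mul_rotPeriod, List.length_tail,
      length_of_mem_words w.2]
  · obtain ⟨a, v, hw, -, hv⟩ := exists_eq_cons_of_mem_words (by omega) w.2
    rw [orbitProd_rotTailWord q hm, ← pow_mul, hw, List.tail_cons,
      Nat.div_mul_cancel (dvd_N_of_dvd_gcdVec_sub (exponent_dvd_gcdVec hv))]

theorem dvd_dPrime_iff (hQ : evalAt q (Q m) ^ N m = 1) {r : ℕ} (hr : r ∣ N m) :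
    r ∣ dPrime q m ↔ evalAt q (Q m) ^ (N m / r) = 1 := by
  rw [dPrime, ← orderOf_dvd_iff_pow_eq_one, Nat.dvd_div_iff_mul_dvd (orderOf_dvd_of_pow_eq_one hQ),
    Nat.dvd_div_iff_mul_dvd hr, Nat.mul_comm]

open Classical in
theorem sum_lyndonCount_dvd_dPrime {l : Fin n → ℕ} (hQ : evalAt q (Q m) ^ N m = 1)
    (hl : ∀ r, r ∣ gcdVec l → r ∣ N m) :
    ∑ k ∈ (gcdVec l).divisors with k ∣ dPrime q m, lyndonCount (divVec l k) =
      ∑ k ∈ (gcdVec l).divisors,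
        if evalAt q (Q m) ^ (N m / k) = 1 then lyndonCount (divVec l k) else 0 := by
  rw [Finset.sum_filter]
  refine Finset.sum_congr rfl fun k hk => ?_
  simp only [dvd_dPrime_iff q hQ (hl k (Nat.dvd_of_mem_divisors hk))]

open Classical in
theorem sum_necklaces_pow_eq_one {l : Fin n → ℕ} (hl : 0 < size l)
    (hQ : evalAt q (Q m) ^ N m = 1) (hlm : ∀ r, r ∣ gcdVec l → r ∣ N m) :
    ∑ w ∈ words l with IsNecklace w, (if evalAt q (Q m) ^ (N m / exponent w) = 1 then 1 else 0) =
      ∑ k ∈ (gcdVec l).divisors with k ∣ dPrime q m, lyndonCount (divVec l k) := by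
  rw [sum_necklaces_exponent hl fun k => if evalAt q (Q m) ^ (N m / k) = 1 then 1 else 0,
    sum_lyndonCount_dvd_dPrime q hQ hlm]
  simp only [ite_mul, one_mul, zero_mul]

theorem finrank_ker_one_sub_moveOp (hm : 2 ≤ size m) (hQ : evalAt q (Q m) ^ N m = 1) :
    Module.finrank K (LinearMap.ker (1 - moveOp q m (size m - 1))) = n₂ q m := by
  classical
  rw [moveOp_size_sub_one q (by omega),
    finrank_ker_one_sub_monomialOp rotWord_injective (isOrbitTransversal_necklaces m), n₂,
    ← sum_necklaces_pow_eq_one q (by omega) hQ fun r => dvd_N_of_dvd_gcdVec,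
    Finset.card_filter, Finset.sum_filter, Finset.sum_filter, ← Finset.sum_coe_sort (words m)]
  simp only [orbitProd_rotWord q hm]

theorem finrank_ker_one_sub_twistOp (hm : 2 ≤ size m) (hQ : evalAt q (Q m) ^ N m = 1) :
    Module.finrank K (LinearMap.ker (1 - twistOp q m)) = n₁ q m := by
  classical
  have hm0 : 0 < size m := by omega
  rw [twistOp_eq q hm, finrank_ker_one_sub_monomialOp rotTailWord_injective
    (isOrbitTransversal_necklace_tails hm0), Finset.card_filter, Finset.sum_filter]
  simp only [orbitProd_rotTailWord q hm]
  rw [Finset.sum_coe_sort (words m) fun w => if IsNecklace w.tail then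
    if evalAt q (Q m) ^ (N m / exponent w.tail) = 1 then 1 else 0 else 0,
    sum_words_eq_sum_cons hm0, n₁]
  refine Finset.sum_congr rfl fun a ha => ?_
  have hsize : 0 < size (m - e a) := by rw [size_sub_e (Finset.mem_filter.1 ha).2]; omega
  rw [← sum_necklaces_pow_eq_one q hsize hQ fun r => dvd_N_of_dvd_gcdVec_sub,
    Finset.sum_filter]
  rfl

theorem finrank_ker_shuffleOp (hm : 2 ≤ size m) (hK : (size m : K) ≠ 0)
    (hQ : evalAt q (Q m) ^ N m = 1)
    (hinj : Function.Injective
      (∑ t ∈ Finset.range (size m - 1), moveOp q m t : Module.End K (words m →₀ K))) :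
    Module.finrank K (LinearMap.ker (shuffleOp q m)) + n₂ q m = n₁ q m := by
  have hsize : size m - 1 + 1 = size m := by omega
  have hadd := finrank_ker_sum_add (moveOp_zero q) (fun t => moveOp_mul_twistOp q hm)
    (by rw [twistOp_pow q hm, hQ, one_smul])
    (by rw [hsize, moveOp_size_sub_one_pow q hm, hQ, one_smul]) (by rwa [hsize]) hinj
  rwa [hsize, finrank_ker_one_sub_moveOp q hm hQ, finrank_ker_one_sub_twistOp q hm hQ] at hadd

theorem injective_shuffleOp_of_ne_one (hm : 2 ≤ size m) (hQ : evalAt q (Q m) ^ N m ≠ 1)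
    (hinj : Function.Injective
      (∑ t ∈ Finset.range (size m - 1), moveOp q m t : Module.End K (words m →₀ K))) :
    Function.Injective (shuffleOp q m) := by
  have hsize : size m - 1 + 1 = size m := by omega
  have hker := ker_sum_le (moveOp_zero q) (fun t => moveOp_mul_twistOp q hm) hinj
  rw [hsize] at hker
  rw [← LinearMap.ker_eq_bot, LinearMap.ker_eq_bot']
  intro v hv
  have hpow := pow_apply_of_mem_ker (hker hv) (size m - 1)
  rw [twistOp_pow q hm, LinearMap.smul_apply, Module.End.one_apply, ← sub_eq_zero] at hpow
  nth_rw 2 [← one_smul K v] at hpow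
  rw [← sub_smul] at hpow
  exact (smul_eq_zero.1 hpow).resolve_left (sub_ne_zero.2 hQ)

/-- The map `w ↦ w i` from words of degree `m - e_i` to words of degree `m`. -/
def appendLetter {i : Fin n} (hi : 0 < m i) (w : words (m - e i)) : words m :=
  ⟨w.1 ++ [i], append_singleton_mem_words_iff.2 ⟨hi, w.2⟩⟩

theorem moveOp_appendLetter {i : Fin n} (hi : 0 < m i) {t : ℕ} (ht : t < size m - 1)
    (f : words (m - e i) →₀ K) :
    moveOp q m t (Finsupp.lmapDomain K K (appendLetter hi) f) =
      Finsupp.lmapDomain K K (appendLetter hi) (moveOp q (m - e i) t f) := by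
  induction f using Finsupp.induction_linear with
  | zero => simp only [map_zero]
  | add f g hf hg => simp only [map_add, hf, hg]
  | single w x =>
    have htw : t < w.1.length := by rwa [length_of_mem_words w.2, size_sub_e hi]
    simp only [Finsupp.lmapDomain_apply, Finsupp.mapDomain_single, moveOp, monomialOp_single,
      appendLetter, moveCoef_append_singleton q htw]
    congr 1
    exact Subtype.ext (moveFirst_append_singleton htw i)

-- The sum preserves the last letter `i`, and acts as `shuffleOp q (m - e i)` on the other letters.
theorem injective_sum_moveOp (hm : 2 ≤ size m)
    (h : ∀ i, 0 < m i → Function.Injective (shuffleOp q (m - e i))) :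
    Function.Injective
      (∑ t ∈ Finset.range (size m - 1), moveOp q m t : Module.End K (words m →₀ K)) := by
  rw [LinearMap.injective_iff_surjective, ← LinearMap.range_eq_top, eq_top_iff,
    ← Finsupp.basisSingleOne.span_eq, Submodule.span_le]
  rintro _ ⟨⟨w, hw⟩, rfl⟩
  rcases List.eq_nil_or_concat' w with rfl | ⟨v, i, rfl⟩
  · exact absurd rfl (ne_nil_of_mem_words (by omega) hw)
  obtain ⟨hi, hv⟩ := append_singleton_mem_words_iff.1 hw
  obtain ⟨y, hy⟩ := LinearMap.injective_iff_surjective.1 (h i hi) (Finsupp.single ⟨v, hv⟩ 1)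
  refine ⟨Finsupp.lmapDomain K K (appendLetter hi) y, ?_⟩
  rw [LinearMap.sum_apply, Finset.sum_congr rfl fun t ht =>
    moveOp_appendLetter q hi (Finset.mem_range.1 ht) y, ← map_sum, ← LinearMap.sum_apply,
    ← size_sub_e hi, ← shuffleOp, hy, Finsupp.lmapDomain_apply, Finsupp.mapDomain_single,
    Finsupp.coe_basisSingleOne]
  rfl

end ShuffleKernelDimension

section SmallDegrees

variable {n : ℕ} {i j : Fin n}

theorem nsmul_e_apply (i k : Fin n) (a : ℕ) : (a • e i) k = if k = i then a else 0 := by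
  simp [e, Pi.single_apply]

theorem size_nsmul_e (i : Fin n) (a : ℕ) : size (a • e i) = a := by
  simp only [size, nsmul_e_apply, Finset.sum_ite_eq', Finset.mem_univ, if_true]

theorem gcdVec_nsmul_e (i : Fin n) (a : ℕ) : gcdVec (a • e i) = a := by
  refine Nat.dvd_antisymm ?_ (Finset.dvd_gcd fun k _ => Dvd.intro _ rfl)
  simpa only [nsmul_e_apply, if_true] using gcdVec_dvd (a • e i) i

theorem divVec_nsmul_e (i : Fin n) (a r : ℕ) : divVec (a • e i) r = (a / r) • e i := by
  funext k
  simp only [divVec, nsmul_e_apply, apply_ite (· / r), Nat.zero_div]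

theorem nsmul_e_sub (i : Fin n) (a : ℕ) : a • e i - e i = (a - 1) • e i := by
  funext k
  rcases eq_or_ne k i with rfl | hk
  · rw [sub_e_self, nsmul_e_apply, nsmul_e_apply, if_pos rfl, if_pos rfl]
  · rw [sub_e_of_ne _ hk, nsmul_e_apply, nsmul_e_apply, if_neg hk, if_neg hk]

theorem filter_pos_nsmul_e (i : Fin n) {a : ℕ} (ha : 0 < a) :
    (Finset.univ.filter fun k => 0 < (a • e i) k) = {i} := by
  ext k
  rw [Finset.mem_filter_univ, nsmul_e_apply, Finset.mem_singleton]
  grind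

theorem N_nsmul_e (i : Fin n) (a : ℕ) : N (a • e i) = a * (a - 1) := by
  refine Nat.dvd_antisymm ?_ (dvd_N fun k l => ?_)
  · simpa only [nsmul_e_apply, if_true] using N_dvd_mul_pred (a • e i) i
  · rcases eq_or_ne k i with rfl | hk
    · rw [nsmul_e_sub, nsmul_e_apply, nsmul_e_apply, if_pos rfl, Nat.mul_comm a]
      split_ifs <;> simp
    · rw [nsmul_e_apply i k, if_neg hk, Nat.mul_zero]
      exact dvd_zero _

/-- The degree `a e_i + b e_j`. -/
def pairDeg (i j : Fin n) (a b : ℕ) : Fin n → ℕ := a • e i + b • e j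

theorem pairDeg_comm (i j : Fin n) (a b : ℕ) : pairDeg i j a b = pairDeg j i b a :=
  add_comm _ _

theorem pairDeg_apply (hij : i ≠ j) (a b : ℕ) (k : Fin n) :
    pairDeg i j a b k = if k = i then a else if k = j then b else 0 := by
  rw [pairDeg, Pi.add_apply, nsmul_e_apply, nsmul_e_apply]
  grind

theorem size_pairDeg (i j : Fin n) (a b : ℕ) : size (pairDeg i j a b) = a + b := by
  rw [pairDeg, size_add, size_nsmul_e, size_nsmul_e]

theorem gcdVec_pairDeg (hij : i ≠ j) (a b : ℕ) : gcdVec (pairDeg i j a b) = a.gcd b := by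
  refine Nat.dvd_antisymm (Nat.dvd_gcd ?_ ?_) (Finset.dvd_gcd fun k _ => ?_)
  · simpa [pairDeg_apply hij] using gcdVec_dvd (pairDeg i j a b) i
  · simpa [pairDeg_apply hij, hij.symm] using gcdVec_dvd (pairDeg i j a b) j
  · exact dvd_add ((Nat.gcd_dvd_left a b).mul_right _) ((Nat.gcd_dvd_right a b).mul_right _)

theorem divVec_pairDeg (hij : i ≠ j) (a b r : ℕ) :
    divVec (pairDeg i j a b) r = pairDeg i j (a / r) (b / r) := by
  funext k
  simp only [divVec, pairDeg_apply hij, apply_ite (· / r), Nat.zero_div]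

theorem pairDeg_sub_left (hij : i ≠ j) (a b : ℕ) :
    pairDeg i j a b - e i = pairDeg i j (a - 1) b := by
  funext k
  rcases eq_or_ne k i with rfl | hk
  · simp only [sub_e_self, pairDeg_apply hij, if_true]
  · simp [sub_e_of_ne _ hk, pairDeg_apply hij, hk]

theorem pairDeg_sub_right (hij : i ≠ j) (a b : ℕ) :
    pairDeg i j a b - e j = pairDeg i j a (b - 1) := by
  rw [pairDeg_comm, pairDeg_sub_left hij.symm, pairDeg_comm]

theorem filter_pos_pairDeg (hij : i ≠ j) {a b : ℕ} (ha : 0 < a) (hb : 0 < b) :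
    (Finset.univ.filter fun k => 0 < pairDeg i j a b k) = {i, j} := by
  ext k
  simp only [Finset.mem_filter_univ, pairDeg_apply hij, Finset.mem_insert, Finset.mem_singleton]
  grind

theorem N_pairDeg (hij : i ≠ j) (a b : ℕ) :
    N (pairDeg i j a b) = ((a * (a - 1)).gcd (b * (b - 1))).gcd (a * b) := by
  refine Nat.dvd_antisymm (Nat.dvd_gcd (Nat.dvd_gcd ?_ ?_) ?_) (dvd_N fun k l => ?_)
  · simpa [pairDeg_apply hij] using N_dvd_mul_pred (pairDeg i j a b) i
  · simpa [pairDeg_apply hij, hij.symm] using N_dvd_mul_pred (pairDeg i j a b) j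
  · simpa [pairDeg_apply hij, hij.symm] using N_dvd_mul_of_ne (pairDeg i j a b) hij
  · have haa := (Nat.gcd_dvd_left _ (a * b)).trans (Nat.gcd_dvd_left (a * (a - 1)) (b * (b - 1)))
    have hbb := (Nat.gcd_dvd_left _ (a * b)).trans (Nat.gcd_dvd_right (a * (a - 1)) (b * (b - 1)))
    have hab := Nat.gcd_dvd_right ((a * (a - 1)).gcd (b * (b - 1))) (a * b)
    rcases eq_or_ne k i with rfl | hki
    · rw [pairDeg_sub_left hij, pairDeg_apply hij, pairDeg_apply hij, if_pos rfl]
      split_ifs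
      exacts [haa.trans (Nat.mul_comm ..).dvd, hab.trans (Nat.mul_comm ..).dvd, by simp]
    rcases eq_or_ne k j with rfl | hkj
    · rw [pairDeg_sub_right hij, pairDeg_apply hij, pairDeg_apply hij, if_neg hki, if_pos rfl]
      split_ifs
      exacts [hab, hbb.trans (Nat.mul_comm ..).dvd, by simp]
    · simp [pairDeg_apply hij, hki, hkj]

theorem card_words_zero : (words (0 : Fin n → ℕ)).card = 1 := by
  refine Finset.card_eq_one.2 ⟨[], Finset.ext fun w => ?_⟩
  rw [mem_words, Finset.mem_singleton]
  refine ⟨fun h => List.length_eq_zero_iff.1 ?_, fun h => ?_⟩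
  · rw [length_of_mem_words (mem_words.2 h)]
    simp [size]
  · funext k
    simp [h, wordDegree]

theorem card_words_eq_sum {m : Fin n → ℕ} (hm : 0 < size m) :
    (words m).card = ∑ i : Fin n with 0 < m i, (words (m - e i)).card := by
  simp only [Finset.card_eq_sum_ones]
  exact sum_words_eq_sum_cons hm fun _ => 1

theorem card_words_nsmul_e (i : Fin n) (a : ℕ) : (words (a • e i)).card = 1 := by
  induction a with
  | zero => rw [zero_smul, card_words_zero]
  | succ a ih =>
    rw [card_words_eq_sum (by rw [size_nsmul_e]; omega), filter_pos_nsmul_e i a.succ_pos,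
      Finset.sum_singleton, nsmul_e_sub, Nat.add_sub_cancel, ih]

theorem card_words_pairDeg (hij : i ≠ j) (a b : ℕ) :
    (words (pairDeg i j a b)).card = (a + b).choose a := by
  induction h : a + b generalizing a b with
  | zero =>
    obtain ⟨rfl, rfl⟩ : a = 0 ∧ b = 0 := by omega
    simp [pairDeg, card_words_zero]
  | succ s ih =>
    rcases a with - | a
    · rw [pairDeg, zero_smul, zero_add, card_words_nsmul_e, Nat.choose_zero_right]
    rcases Nat.eq_zero_or_pos b with rfl | hb
    · rw [pairDeg, zero_smul, add_zero, card_words_nsmul_e, ← h, add_zero, Nat.choose_self]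
    rw [card_words_eq_sum (by rw [size_pairDeg]; omega), filter_pos_pairDeg hij a.succ_pos hb,
      Finset.sum_pair hij, pairDeg_sub_left hij, pairDeg_sub_right hij, ih _ _ (by omega),
      ih _ _ (by omega), Nat.choose_succ_succ, Nat.add_sub_cancel]

theorem lyndonCount_nsmul_e (i : Fin n) {a : ℕ} (ha : 0 < a) :
    lyndonCount (a • e i) = if a = 1 then 1 else 0 := by
  have hsum {a : ℕ} (ha : 0 < a) :
      ∑ r ∈ a.divisors, a / r * lyndonCount ((a / r) • e i) = 1 := by
    have h := card_words (m := a • e i) (by rwa [size_nsmul_e])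
    simp only [gcdVec_nsmul_e, card_words_nsmul_e, size_nsmul_e, divVec_nsmul_e] at h
    exact h.symm
  have hone : lyndonCount (1 • e i) = 1 := by simpa using hsum Nat.one_pos
  split_ifs with ha1
  · rw [ha1, hone]
  · have h := hsum ha
    rw [← Finset.add_sum_erase _ _ (Nat.mem_divisors_self a ha.ne'), Nat.div_self ha, hone,
      Nat.mul_one, Nat.add_eq_left, Finset.sum_eq_zero_iff] at h
    have h₁ := h 1 (by simp [ha.ne', Ne.symm ha1])
    rw [Nat.div_one] at h₁
    exact (Nat.mul_eq_zero.1 h₁).resolve_left ha.ne'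

theorem sum_lyndonCount_nsmul_e (i : Fin n) {a : ℕ} (ha : 0 < a) (s : ℕ → Prop)
    [DecidablePred s] :
    ∑ r ∈ a.divisors, (if s r then lyndonCount ((a / r) • e i) else 0) =
      if s a then 1 else 0 := by
  rw [Finset.sum_eq_single_of_mem a (Nat.mem_divisors_self a ha.ne'), Nat.div_self ha,
    lyndonCount_nsmul_e i Nat.one_pos, if_pos rfl]
  intro r hr hra
  have hr := Nat.dvd_of_mem_divisors hr
  have hpos : 0 < a / r := Nat.div_pos (Nat.le_of_dvd ha hr) (Nat.pos_of_dvd_of_pos hr ha)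
  rw [lyndonCount_nsmul_e i hpos, if_neg fun h => hra (Nat.eq_of_dvd_of_div_eq_one hr h), ite_self]

theorem sum_lyndonCount_pairDeg (hij : i ≠ j) {a b : ℕ} (hab : 0 < a + b) :
    ∑ r ∈ (a.gcd b).divisors, (a + b) / r * lyndonCount (pairDeg i j (a / r) (b / r)) =
      (a + b).choose a := by
  have h := card_words (m := pairDeg i j a b) (by rwa [size_pairDeg])
  simp only [gcdVec_pairDeg hij, card_words_pairDeg hij, size_pairDeg, divVec_pairDeg hij] at h
  exact h.symm

theorem lyndonCount_one_left (hij : i ≠ j) (b : ℕ) : lyndonCount (pairDeg i j 1 b) = 1 := by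
  have h : (1 + b) * lyndonCount (pairDeg i j 1 b) = (1 + b) * 1 := by
    simpa using sum_lyndonCount_pairDeg hij (a := 1) (b := b) (by omega)
  exact Nat.eq_of_mul_eq_mul_left (by omega) h

theorem lyndonCount_two_left (hij : i ≠ j) (b : ℕ) :
    lyndonCount (pairDeg i j 2 b) = (b + 1) / 2 := by
  have h := sum_lyndonCount_pairDeg hij (a := 2) (b := b) (by omega)
  have hchoose : (2 + b).choose 2 * 2 = (b + 2) * (b + 1) := by
    rw [Nat.choose_two_right, Nat.div_mul_cancel (Nat.even_mul_pred_self _).two_dvd]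
    congr 1 <;> omega
  obtain ⟨s, rfl | rfl⟩ := Nat.even_or_odd' b
  · rw [Nat.gcd_mul_right_right, Nat.prime_two.divisors, Finset.sum_pair (by norm_num)] at h
    simp only [Nat.div_one, Nat.div_self two_pos, Nat.mul_div_cancel_left s two_pos,
      lyndonCount_one_left hij, Nat.mul_one, show (2 + 2 * s) / 2 = s + 1 by omega] at h
    have : (s + 1) * (2 * lyndonCount (pairDeg i j 2 (2 * s)) + 1) = (s + 1) * (2 * s + 1) := by
      linarith
    have := Nat.eq_of_mul_eq_mul_left s.succ_pos this
    omega
  · rw [show Nat.gcd 2 (2 * s + 1) = 1 by simp, Nat.divisors_one, Finset.sum_singleton,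
      Nat.div_one, Nat.div_one, Nat.div_one] at h
    have : (2 + (2 * s + 1)) * lyndonCount (pairDeg i j 2 (2 * s + 1)) =
        (2 + (2 * s + 1)) * (s + 1) := by
      linarith
    have := Nat.eq_of_mul_eq_mul_left (by omega) this
    omega

theorem divisors_three : Nat.divisors 3 = {1, 3} := by decide

theorem divisors_four : Nat.divisors 4 = {1, 2, 4} := by decide

theorem lyndonCount_three_two (hij : i ≠ j) : lyndonCount (pairDeg i j 3 2) = 2 := by
  rw [pairDeg_comm, lyndonCount_two_left hij.symm]

theorem lyndonCount_three_three (hij : i ≠ j) : lyndonCount (pairDeg i j 3 3) = 3 := by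
  have h := sum_lyndonCount_pairDeg hij (a := 3) (b := 3) (by omega)
  norm_num [divisors_three, lyndonCount_one_left hij, Nat.choose] at h
  omega

theorem lyndonCount_three_four (hij : i ≠ j) : lyndonCount (pairDeg i j 3 4) = 5 := by
  have h := sum_lyndonCount_pairDeg hij (a := 3) (b := 4) (by omega)
  norm_num [Nat.choose] at h
  omega

theorem lyndonCount_three_five (hij : i ≠ j) : lyndonCount (pairDeg i j 3 5) = 7 := by
  have h := sum_lyndonCount_pairDeg hij (a := 3) (b := 5) (by omega)
  norm_num [Nat.choose] at h
  omega

theorem lyndonCount_three_six (hij : i ≠ j) : lyndonCount (pairDeg i j 3 6) = 9 := by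
  have h := sum_lyndonCount_pairDeg hij (a := 3) (b := 6) (by omega)
  norm_num [divisors_three, lyndonCount_one_left hij, Nat.choose] at h
  omega

theorem lyndonCount_four_three (hij : i ≠ j) : lyndonCount (pairDeg i j 4 3) = 5 := by
  rw [pairDeg_comm, lyndonCount_three_four hij.symm]

theorem lyndonCount_four_four (hij : i ≠ j) : lyndonCount (pairDeg i j 4 4) = 8 := by
  have h := sum_lyndonCount_pairDeg hij (a := 4) (b := 4) (by omega)
  norm_num [divisors_four, lyndonCount_one_left hij, lyndonCount_two_left hij, Nat.choose] at h
  omega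

end SmallDegrees

section Criterion

variable {n : ℕ} {K : Type*} [Field K] {q : Fin n → Fin n → K} {i j : Fin n} {m : Fin n → ℕ}

theorem evalAt_Q_nsmul_e (i : Fin n) {a : ℕ} (ha : 2 ≤ a) : evalAt q (Q (a • e i)) = q i i := by
  have hpos : 0 < a * (a - 1) := Nat.mul_pos (by omega) (by omega)
  have hne (k : Fin n) (hk : k ≠ i) : (a • e i) k = 0 := by rw [nsmul_e_apply, if_neg hk]
  rw [evalAt_Q, Fintype.prod_eq_single i, Fintype.prod_eq_single i]
  · rw [N_nsmul_e, sub_e_self, nsmul_e_apply, if_pos rfl, Nat.mul_comm, Nat.div_self hpos, pow_one]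
  · intro k hk
    rw [sub_e_of_ne _ hk, hne k hk, Nat.zero_mul, Nat.zero_div, pow_zero]
  · intro k hk
    simp only [hne k hk, Nat.mul_zero, Nat.zero_div, pow_zero, Finset.prod_const_one]

theorem evalAt_Q_pairDeg (hij : i ≠ j) (a b : ℕ) :
    evalAt q (Q (pairDeg i j a b)) =
      q i i ^ (a * (a - 1) / N (pairDeg i j a b)) * q j j ^ (b * (b - 1) / N (pairDeg i j a b)) *
        (q i j * q j i) ^ (a * b / N (pairDeg i j a b)) := by
  have hne (k : Fin n) (hk : k ≠ i ∧ k ≠ j) (a b : ℕ) : pairDeg i j a b k = 0 := by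
    rw [pairDeg_apply hij, if_neg hk.1, if_neg hk.2]
  rw [evalAt_Q, Fintype.prod_eq_mul i j hij, Fintype.prod_eq_mul i j hij,
    Fintype.prod_eq_mul i j hij]
  · simp only [pairDeg_sub_left hij, pairDeg_sub_right hij, pairDeg_apply hij, if_true,
      if_neg hij.symm]
    rw [Nat.mul_comm (a - 1), Nat.mul_comm b a, Nat.mul_comm (b - 1)]
    ring
  · intro k hk
    rw [pairDeg_sub_right hij, hne k hk, Nat.zero_mul, Nat.zero_div, pow_zero]
  · intro k hk
    rw [pairDeg_sub_left hij, hne k hk, Nat.zero_mul, Nat.zero_div, pow_zero]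
  · intro k hk
    simp only [hne k hk, Nat.mul_zero, Nat.zero_div, pow_zero, Finset.prod_const_one]

theorem pow_eq_one_of_qInt_eq_zero {a : ℕ} {z : K} (h : qInt a z = 0) : z ^ a = 1 := by
  rw [← sub_eq_zero, ← geom_sum_mul, ← qInt, h, zero_mul]

theorem eq_one_of_qInt_ne_zero {a : ℕ} {z : K} (h : qInt a z ≠ 0) (hz : z ^ a = 1) : z = 1 := by
  rw [← sub_eq_zero, ← geom_sum_mul, ← qInt] at hz
  exact sub_eq_zero.1 ((mul_eq_zero.1 hz).resolve_left h)

/-- The property which makes `P_m` a criterion for the kernel of `S_{1,|m|-1}` in degree `m`,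
provided that there is no kernel in smaller degrees: if `f` vanishes at `q`, then the dimension of
the kernel is given by the numbers `n₁(q)` and `n₂(q)`, and otherwise the kernel is zero. -/
structure Detects (q : Fin n → Fin n → K) (m : Fin n → ℕ)
    (f : MvPolynomial (Fin n × Fin n) ℤ) : Prop where
  pow_N_eq_one : evalAt q f = 0 → evalAt q (Q m) ^ N m = 1
  n₁_le_n₂ : evalAt q (Q m) ^ N m = 1 → evalAt q f ≠ 0 → n₁ q m ≤ n₂ q m

theorem detects_nsmul_e (q : Fin n → Fin n → K) (i : Fin n) {a : ℕ} (ha : 2 ≤ a) :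
    Detects q (a • e i) (qInt a (p i i)) := by
  classical
  have hf : evalAt q (qInt a (p i i)) = qInt a (q i i) := by simp [evalAt, p, qInt]
  have hQ := evalAt_Q_nsmul_e (q := q) i ha
  refine ⟨fun h => ?_, fun hz h => ?_⟩
  · rw [hf] at h
    rw [hQ, N_nsmul_e, pow_mul, pow_eq_one_of_qInt_eq_zero h, one_pow]
  · rw [hf] at h
    rw [n₁, n₂, filter_pos_nsmul_e i (by omega), Finset.sum_singleton,
      sum_lyndonCount_dvd_dPrime q hz fun r => dvd_N_of_dvd_gcdVec_sub,
      sum_lyndonCount_dvd_dPrime q hz fun r => dvd_N_of_dvd_gcdVec]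
    simp only [nsmul_e_sub, gcdVec_nsmul_e, divVec_nsmul_e, hQ, N_nsmul_e]
    rw [sum_lyndonCount_nsmul_e i (by omega) fun r => q i i ^ (a * (a - 1) / r) = 1,
      sum_lyndonCount_nsmul_e i (by omega) fun r => q i i ^ (a * (a - 1) / r) = 1,
      Nat.mul_div_cancel _ (by omega), Nat.mul_div_cancel_left _ (by omega)]
    split_ifs with h₁ h₂
    · exact le_rfl
    · exact absurd (by rw [eq_one_of_qInt_ne_zero h h₁, one_pow]) h₂
    · exact zero_le_one
    · exact le_rfl

open Classical in
/-- The sum over `r` which the degree `a e_i + b e_j` contributes to `n₁(q)` or `n₂(q)`, in terms of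
the values `c` of `N(m)` and `z` of `Q_m(q)`. -/
def pairCount (i j : Fin n) (c : ℕ) (z : K) (a b : ℕ) : ℕ :=
  ∑ r ∈ (a.gcd b).divisors, if z ^ (c / r) = 1 then lyndonCount (pairDeg i j (a / r) (b / r)) else 0

theorem detects_pairDeg (hij : i ≠ j) {a b c : ℕ} (ha : 0 < a) (hb : 0 < b)
    (hN : N (pairDeg i j a b) = c) {f : MvPolynomial (Fin n × Fin n) ℤ} (g : K → K)
    (hf : evalAt q f = g (evalAt q (Q (pairDeg i j a b))))
    (hpow : ∀ z, g z = 0 → z ^ c = 1)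
    (hle : ∀ z, z ^ c = 1 → g z ≠ 0 →
      pairCount i j c z (a - 1) b + pairCount i j c z a (b - 1) ≤ pairCount i j c z a b) :
    Detects q (pairDeg i j a b) f := by
  subst hN
  refine ⟨fun h => hpow _ (hf ▸ h), fun hQ h => ?_⟩
  have hle := hle _ hQ (hf ▸ h)
  rw [n₁, n₂, filter_pos_pairDeg hij ha hb, Finset.sum_pair hij,
    sum_lyndonCount_dvd_dPrime q hQ fun r => dvd_N_of_dvd_gcdVec_sub,
    sum_lyndonCount_dvd_dPrime q hQ fun r => dvd_N_of_dvd_gcdVec_sub,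
    sum_lyndonCount_dvd_dPrime q hQ fun r => dvd_N_of_dvd_gcdVec]
  simpa only [pairCount, pairDeg_sub_left hij, pairDeg_sub_right hij, gcdVec_pairDeg hij,
    divVec_pairDeg hij] using hle

theorem detects_one (hij : i ≠ j) {b : ℕ} (hb : 0 < b) :
    Detects q (pairDeg i j 1 b) (1 - p j j ^ (b - 1) * (p i j * p j i)) := by
  have hN : N (pairDeg i j 1 b) = b := by rw [N_pairDeg hij]; simp
  refine detects_pairDeg hij one_pos hb hN (fun z => 1 - z) ?_ (fun z h => ?_) fun z hz h => ?_
  · rw [evalAt_Q_pairDeg hij, hN, Nat.mul_div_cancel_left _ hb]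
    simp [evalAt, p, Nat.div_self hb]
  · rw [← sub_eq_zero.1 h, one_pow]
  · have hz₁ : z ≠ 1 := fun h₁ => h (by rw [h₁, sub_self])
    classical
    have hzero : pairCount i j b z 0 b = 0 := by
      simp only [pairCount, pairDeg, Nat.gcd_zero_left, Nat.zero_div, zero_smul, zero_add]
      rw [sum_lyndonCount_nsmul_e j hb fun r => z ^ (b / r) = 1, Nat.div_self hb, pow_one,
        if_neg hz₁]
    rw [Nat.sub_self, hzero]
    simp [pairCount, hz, lyndonCount_one_left hij]

theorem detects_two (hij : i ≠ j) {b : ℕ} (hb : 0 < b) :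
    Detects q (pairDeg i j 2 b)
      (1 + p j j ^ (b * (b - 1) / 2) * (-(p i j * p j i)) ^ b * p i i) := by
  have hN : N (pairDeg i j 2 b) = 2 := by
    rw [N_pairDeg hij]
    simp [Nat.gcd_eq_left (Nat.even_mul_pred_self b).two_dvd]
  refine detects_pairDeg hij two_pos hb hN (fun z => 1 + (-1) ^ b * z) ?_ (fun z h => ?_)
    fun z hz h => ?_
  · rw [evalAt_Q_pairDeg hij, hN, Nat.mul_div_cancel_left b two_pos]
    simp only [evalAt, p, map_add, map_one, map_mul, map_pow, map_neg, MvPolynomial.aeval_X,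
      neg_pow (q i j * q j i), Nat.reduceSub, mul_one, Nat.div_self two_pos, pow_one]
    ring
  · have hsign : (-1 : K) ^ b * (-1) ^ b = 1 := by rw [← mul_pow]; simp
    linear_combination ((-1) ^ b * z - 1) * h - z ^ 2 * hsign
  · obtain ⟨s, rfl | rfl⟩ := Nat.even_or_odd' b
    · have hz₁ : z = 1 := by
        rw [(even_two_mul s).neg_one_pow, one_mul] at h
        have hprod : (z - 1) * (1 + z) = 0 := by linear_combination hz
        exact sub_eq_zero.1 ((mul_eq_zero.1 hprod).resolve_right h)
      obtain ⟨s, rfl⟩ := Nat.exists_eq_succ_of_ne_zero (show s ≠ 0 by omega)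
      have hgcd : Nat.gcd 2 (2 * s.succ - 1) = 1 := by
        rw [show 2 * s.succ - 1 = 2 * s + 1 by omega]; simp
      simp only [pairCount, hz₁, one_pow, if_true, Nat.reduceSub, Nat.gcd_one_left, hgcd,
        Nat.gcd_mul_right_right, Nat.divisors_one, Nat.prime_two.divisors, Finset.sum_singleton,
        Finset.sum_pair (OfNat.one_ne_ofNat 2), Nat.div_one, Nat.div_self two_pos,
        Nat.mul_div_cancel_left _ two_pos, lyndonCount_one_left hij, lyndonCount_two_left hij]
      omega
    · have hz₁ : z ≠ 1 := by
        rintro rfl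
        exact h (by rw [(odd_two_mul_add_one s).neg_one_pow]; ring)
      have hgcd : Nat.gcd 2 (2 * s + 1) = 1 := by simp
      simp only [pairCount, hz, hz₁, if_true, if_false, pow_one, Nat.reduceSub,
        Nat.add_sub_cancel, Nat.gcd_one_left, hgcd, Nat.gcd_mul_right_right, Nat.divisors_one,
        Nat.prime_two.divisors, Finset.sum_singleton, Finset.sum_pair (OfNat.one_ne_ofNat 2),
        Nat.div_one, Nat.div_self two_pos, lyndonCount_one_left hij, lyndonCount_two_left hij]
      omega

theorem detects_three_three (hij : i ≠ j) :
    Detects q (pairDeg i j 3 3) (qInt 3 (p i i ^ 2 * (p i j * p j i) ^ 3 * p j j ^ 2)) := by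
  have hN : N (pairDeg i j 3 3) = 3 := by rw [N_pairDeg hij]; norm_num
  refine detects_pairDeg hij three_pos three_pos hN (qInt 3) ?_
    (fun z => pow_eq_one_of_qInt_eq_zero) fun z hz h => ?_
  · rw [evalAt_Q_pairDeg hij, hN]
    simp only [evalAt, p, qInt, Finset.sum_range_succ, Finset.sum_range_zero, pow_zero, pow_one,
      map_zero, map_one, map_add, map_mul, map_pow, MvPolynomial.aeval_X, Nat.reduceSub,
      Nat.reduceMul, Nat.reduceDiv]
    ring
  · have hz₁ : z = 1 := eq_one_of_qInt_ne_zero h hz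
    norm_num [pairCount, hz₁, divisors_three, lyndonCount_one_left hij,
      lyndonCount_two_left hij, lyndonCount_three_two hij, lyndonCount_three_three hij]

theorem detects_three_four (hij : i ≠ j) :
    Detects q (pairDeg i j 3 4) ((1 - p i i ^ 2 * (p i j * p j i) ^ 4 * p j j ^ 4) *
      qInt 3 (p i i * (p i j * p j i) ^ 2 * p j j ^ 2)) := by
  have hN : N (pairDeg i j 3 4) = 6 := by rw [N_pairDeg hij]; norm_num
  refine detects_pairDeg hij three_pos four_pos hN (fun z => (1 - z ^ 2) * qInt 3 z) ?_
    (fun z h => ?_) fun z hz h => ?_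
  · rw [evalAt_Q_pairDeg hij, hN]
    simp only [evalAt, p, qInt, Finset.sum_range_succ, Finset.sum_range_zero, pow_zero, pow_one,
      map_zero, map_one, map_add, map_sub, map_mul, map_pow, MvPolynomial.aeval_X, Nat.reduceSub,
      Nat.reduceMul, Nat.reduceDiv]
    ring
  · rcases mul_eq_zero.1 h with h | h
    · rw [pow_mul z 2 3, ← sub_eq_zero.1 h, one_pow]
    · rw [pow_mul z 3 2, pow_eq_one_of_qInt_eq_zero h, one_pow]
  · have hz₂ : z ^ 2 ≠ 1 := fun h₂ => h (by rw [h₂, sub_self, zero_mul])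
    have hz₃ : z ^ 3 ≠ 1 := fun h₃ =>
      hz₂ (by rw [eq_one_of_qInt_ne_zero (right_ne_zero_of_mul h) h₃, one_pow])
    norm_num [pairCount, hz, hz₂, hz₃, divisors_three, Nat.prime_two.divisors,
      lyndonCount_two_left hij, lyndonCount_three_three hij, lyndonCount_three_four hij]

theorem detects_three_six (hij : i ≠ j) :
    Detects q (pairDeg i j 3 6) ((1 - p i i * (p i j * p j i) ^ 3 * p j j ^ 5) *
      qInt 3 (p i i ^ 2 * (p i j * p j i) ^ 6 * p j j ^ 10)) := by
  have hN : N (pairDeg i j 3 6) = 6 := by rw [N_pairDeg hij]; norm_num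
  refine detects_pairDeg hij three_pos (by norm_num) hN (fun z => (1 - z) * qInt 3 (z ^ 2)) ?_
    (fun z h => ?_) fun z hz h => ?_
  · rw [evalAt_Q_pairDeg hij, hN]
    simp only [evalAt, p, qInt, Finset.sum_range_succ, Finset.sum_range_zero, pow_zero, pow_one,
      map_zero, map_one, map_add, map_sub, map_mul, map_pow, MvPolynomial.aeval_X, Nat.reduceSub,
      Nat.reduceMul, Nat.reduceDiv]
    ring
  · rcases mul_eq_zero.1 h with h | h
    · rw [← sub_eq_zero.1 h, one_pow]
    · rw [pow_mul z 2 3, pow_eq_one_of_qInt_eq_zero h]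
  · have hz₁ : z ≠ 1 := fun h₁ => h (by rw [h₁, sub_self, zero_mul])
    have hz₂ : z ^ 2 = 1 :=
      eq_one_of_qInt_ne_zero (right_ne_zero_of_mul h) (by rw [← pow_mul, hz])
    have hz₃ : z ^ 3 ≠ 1 := by rwa [pow_succ, hz₂, one_mul]
    norm_num [pairCount, hz, hz₂, hz₃, divisors_three, Nat.prime_two.divisors,
      lyndonCount_one_left hij, lyndonCount_two_left hij, lyndonCount_three_five hij,
      lyndonCount_three_six hij]

theorem detects_four_four (hij : i ≠ j) :
    Detects q (pairDeg i j 4 4) ((1 + p i i ^ 3 * (p i j * p j i) ^ 4 * p j j ^ 3) *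
      (1 + p i i ^ 6 * (p i j * p j i) ^ 8 * p j j ^ 6)) := by
  have hN : N (pairDeg i j 4 4) = 4 := by rw [N_pairDeg hij]; norm_num
  refine detects_pairDeg hij four_pos four_pos hN (fun z => (1 + z) * (1 + z ^ 2)) ?_
    (fun z h => ?_) fun z hz h => ?_
  · rw [evalAt_Q_pairDeg hij, hN]
    simp only [evalAt, p, map_one, map_add, map_mul, map_pow, MvPolynomial.aeval_X, Nat.reduceSub,
      Nat.reduceMul, Nat.reduceDiv]
    ring
  · linear_combination (z - 1) * h
  · have hz₁ : z = 1 := by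
      have hprod : (z - 1) * ((1 + z) * (1 + z ^ 2)) = 0 := by linear_combination hz
      exact sub_eq_zero.1 ((mul_eq_zero.1 hprod).resolve_right h)
    norm_num [pairCount, hz₁, divisors_three, divisors_four, lyndonCount_one_left hij,
      lyndonCount_two_left hij, lyndonCount_three_four hij, lyndonCount_four_three hij,
      lyndonCount_four_four hij]

theorem Q_pow_N (m : Fin n → ℕ) :
    Q m ^ N m = (∏ i, p i i ^ (m i * (m i - 1))) *
      ∏ a : Fin n × Fin n with a.1 < a.2, (p a.1 a.2 * p a.2 a.1) ^ (m a.1 * m a.2) := by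
  simp only [Q, mul_pow _ _ (N m), ← Finset.prod_pow, ← pow_mul]
  congr 1
  · refine Finset.prod_congr rfl fun i _ => ?_
    rw [Nat.div_mul_cancel (N_dvd_mul_pred m i)]
  · refine Finset.prod_congr rfl fun a ha => ?_
    rw [Nat.div_mul_cancel (N_dvd_mul_of_ne m (Finset.mem_filter.1 ha).2.ne)]

theorem detects_one_sub_Q_pow_N (q : Fin n → Fin n → K) (m : Fin n → ℕ) :
    Detects q m (1 - Q m ^ N m) := by
  have hf : evalAt q (1 - Q m ^ N m) = 1 - evalAt q (Q m) ^ N m := by simp [evalAt]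
  refine ⟨fun h => (sub_eq_zero.1 (hf ▸ h)).symm, fun hQ h => absurd ?_ h⟩
  rw [hf, hQ, sub_self]

theorem detects_P (q : Fin n → Fin n → K) (hm : 2 ≤ size m) : Detects q m (P m) := by
  rw [P]
  split_ifs with h₁ h₂ h₃ h₄ h₅ h₆ h₇
  · have hspec := h₁.choose_spec.2
    have h := detects_nsmul_e q h₁.choose (a := m h₁.choose)
      (by rwa [hspec, size_nsmul_e] at hm)
    rwa [← hspec] at h
  · obtain ⟨hij, hb, hspec⟩ := h₂.choose_spec
    have h := detects_one (q := q) hij hb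
    rwa [pairDeg, one_smul, ← hspec] at h
  · obtain ⟨hij, hb, hspec⟩ := h₃.choose_spec
    have h := detects_two (q := q) hij hb
    rwa [pairDeg, ← hspec] at h
  · obtain ⟨hij, hspec⟩ := h₄.choose_spec
    have h := detects_three_three (q := q) hij
    rwa [pairDeg, ← hspec] at h
  · obtain ⟨hij, hspec⟩ := h₅.choose_spec
    have h := detects_three_four (q := q) hij
    rwa [pairDeg, ← hspec] at h
  · obtain ⟨hij, hspec⟩ := h₆.choose_spec
    have h := detects_three_six (q := q) hij
    rwa [pairDeg, ← hspec] at h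
  · obtain ⟨hij, hspec⟩ := h₇.choose_spec
    have h := detects_four_four (q := q) hij
    rwa [pairDeg, ← hspec] at h
  · rw [← Q_pow_N]
    exact detects_one_sub_Q_pow_N q m

theorem sub_e_lt (hi : 0 < m i) : m - e i < m := by
  refine lt_of_le_of_ne (fun k => Nat.sub_le _ _) fun h => ?_
  have := congrFun h i
  rw [sub_e_self] at this
  omega

theorem natCast_ne_zero_of_factorial_ne_zero {s : ℕ} (hs : 0 < s) (h : (s.factorial : K) ≠ 0) :
    (s : K) ≠ 0 :=
  ne_zero_of_dvd_ne_zero h (Nat.cast_dvd_cast (Nat.dvd_factorial hs le_rfl))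

theorem factorial_size_sub_e_ne_zero (hi : 0 < m i) (h : ((size m).factorial : K) ≠ 0) :
    ((size (m - e i)).factorial : K) ≠ 0 := by
  refine ne_zero_of_dvd_ne_zero h (Nat.cast_dvd_cast (Nat.factorial_dvd_factorial ?_))
  rw [size_sub_e hi]
  exact Nat.sub_le _ _

theorem injective_shuffleOp (hm : 1 ≤ size m) (hK : ((size m).factorial : K) ≠ 0)
    (hP : ∀ l : Fin n → ℕ, l ≤ m → 2 ≤ size l → evalAt q (P l) ≠ 0) :
    Function.Injective (shuffleOp q m) := by
  induction hs : size m generalizing m with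
  | zero => omega
  | succ s ih =>
    rcases Nat.eq_zero_or_pos s with rfl | hs₀
    · rw [shuffleOp, hs, Finset.sum_range_one, moveOp_zero]
      exact Function.injective_id
    have hm₂ : 2 ≤ size m := by omega
    have hinj := injective_sum_moveOp q hm₂ fun i hi => by
      have hsize : size (m - e i) = s := by rw [size_sub_e hi]; omega
      exact ih (by omega) (factorial_size_sub_e_ne_zero hi hK)
        (fun l hl => hP l (hl.trans (sub_e_lt hi).le)) hsize
    by_cases hQ : evalAt q (Q m) ^ N m = 1
    · have hdim := finrank_ker_shuffleOp q hm₂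
        (natCast_ne_zero_of_factorial_ne_zero (by omega) hK) hQ hinj
      have hle := (detects_P q hm₂).n₁_le_n₂ hQ (hP m le_rfl hm₂)
      rw [← LinearMap.ker_eq_bot, ← Submodule.finrank_eq_zero (R := K)]
      omega
    · exact injective_shuffleOp_of_ne_one q hm₂ hQ hinj

theorem finrank_ker_shuffleOp_of_minimal (hm : 2 ≤ size m)
    (hK : ((size m).factorial : K) ≠ 0) (hP : evalAt q (P m) = 0)
    (hl : ∀ l : Fin n → ℕ, l < m → 2 ≤ size l → evalAt q (P l) ≠ 0) :
    Module.finrank K (LinearMap.ker (shuffleOp q m)) + n₂ q m = n₁ q m := by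
  refine finrank_ker_shuffleOp q hm (natCast_ne_zero_of_factorial_ne_zero (by omega) hK)
    ((detects_P q hm).pow_N_eq_one hP) (injective_sum_moveOp q hm fun i hi => ?_)
  refine injective_shuffleOp ?_ (factorial_size_sub_e_ne_zero hi hK)
    fun l hlm => hl l (hlm.trans_lt (sub_e_lt hi))
  rw [size_sub_e hi]
  omega

end Criterion

section Tensor

theorem ofFn_comp_swap {α : Type*} {r : ℕ} (g : Fin r → α) (i j : Fin r) :
    List.ofFn (g ∘ Equiv.swap i j) = ((List.ofFn g).set i (g j)).set j (g i) := by
  refine List.ext_getElem (by simp) fun s hs _ => ?_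
  rw [List.length_ofFn] at hs
  simp only [List.getElem_ofFn, List.getElem_set, Function.comp_apply, Equiv.swap_apply_def,
    Fin.ext_iff, eq_comm (a := s)]
  split_ifs with hi hj hj
  · rw [Fin.ext (hi.trans hj.symm)]
  all_goals simp_all

variable {n : ℕ}

section Swap

variable {r : ℕ} {g : Fin r → Fin n} {i : Fin (r - 1)} {L R : List (Fin n)} {a b : Fin n}

theorem apply_posL_of_ofFn_eq (hL : L.length = i) (hg : List.ofFn g = L ++ a :: b :: R) :
    g (posL i) = a := by
  have h := List.getElem_ofFn (f := g) (i := i) (by rw [List.length_ofFn]; omega)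
  simp only [hg, ← hL] at h
  simpa [posL, hL] using h.symm

theorem apply_posR_of_ofFn_eq (hL : L.length = i) (hg : List.ofFn g = L ++ a :: b :: R) :
    g (posR i) = b := by
  have h := List.getElem_ofFn (f := g) (i := i + 1) (by rw [List.length_ofFn]; omega)
  simp only [hg, ← hL] at h
  simpa [posR, hL] using h.symm

theorem ofFn_comp_swap_posL_posR (hL : L.length = i) (hg : List.ofFn g = L ++ a :: b :: R) :
    List.ofFn (g ∘ Equiv.swap (posL i) (posR i)) = L ++ b :: a :: R := by
  rw [ofFn_comp_swap, apply_posL_of_ofFn_eq hL hg, apply_posR_of_ofFn_eq hL hg, hg]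
  simp [posL, posR, ← hL]

end Swap

theorem descProd_succ {r t : ℕ} (ht : t < r - 1) :
    descProd r (t + 1) = σ ⟨t, ht⟩ * descProd r t := by
  rw [descProd, descProd, List.take_succ_eq_append_getElem (by simpa using ht)]
  simp

variable {K : Type*} [Field K] {V : Type*} [AddCommGroup V] [Module K V]
  (x : Module.Basis (Fin n) K V) (q : Fin n → Fin n → K) {m : Fin n → ℕ}

theorem ρ_of_σ {r : ℕ} (i : Fin (r - 1)) :
    ρ x q r (MonoidAlgebra.of K (BraidMonoid r) (σ i)) = braidOp x q i := by
  rw [ρ, MonoidAlgebra.lift_of, σ, PresentedMonoid.lift_of]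

theorem ρ_descProd_wordTensor {r : ℕ} (f : Fin r → Fin n) {t : ℕ} (ht : t < r) :
    ∃ g : Fin r → Fin n, List.ofFn g = moveFirst t (List.ofFn f) ∧
      ρ x q r (MonoidAlgebra.of K (BraidMonoid r) (descProd r t)) (wordTensor x f) =
        moveCoef q t (List.ofFn f) • wordTensor x g := by
  obtain ⟨a, v, hf⟩ := List.exists_cons_of_ne_nil (l := List.ofFn f)
    (by rw [← List.length_pos_iff, List.length_ofFn]; omega)
  have hlen : v.length + 1 = r := by rw [← List.length_cons (a := a), ← hf, List.length_ofFn]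
  rw [hf]
  induction t with
  | zero =>
    have hone : descProd r 0 = 1 := by simp [descProd]
    exact ⟨f, hf, by rw [hone, map_one, map_one, Module.End.one_apply]; simp [moveCoef]⟩
  | succ t ih =>
    obtain ⟨g, hg, hρ⟩ := ih (by omega)
    have htv : t < v.length := by omega
    rw [moveFirst, List.drop_eq_getElem_cons htv] at hg
    have hL : (v.take t).length = (⟨t, by omega⟩ : Fin (r - 1)) := by
      rw [List.length_take]
      exact min_eq_left htv.le
    refine ⟨_, (ofFn_comp_swap_posL_posR hL hg).trans ?_, ?_⟩
    · rw [moveFirst, List.take_succ_eq_append_getElem htv, List.append_assoc,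
        List.singleton_append]
    · rw [descProd_succ (by omega), map_mul, map_mul, Module.End.mul_apply, hρ, map_smul, ρ_of_σ,
        braidOp_wordTensor, apply_posL_of_ofFn_eq hL hg, apply_posR_of_ofFn_eq hL hg, smul_smul,
        moveCoef, moveCoef, List.take_succ_eq_append_getElem htv, List.map_append, List.prod_append,
        List.map_singleton, List.prod_singleton]

/-- A word of degree `m` as a function. -/
def wordFn (w : words m) : Fin (size m) → Fin n :=
  fun t => w.1.get (Fin.cast (length_of_mem_words w.2).symm t)

theorem ofFn_wordFn (w : words m) : List.ofFn (wordFn w) = w.1 :=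
  List.ext_getElem (by simp [length_of_mem_words w.2]) fun s _ _ => by simp [wordFn]

theorem wordFn_eq {w : words m} {g : Fin (size m) → Fin n} (hg : List.ofFn g = w.1) :
    wordFn w = g :=
  List.ofFn_injective ((ofFn_wordFn w).trans hg.symm)

/-- The embedding of the span of the words of degree `m` into the tensor power; its image
is `V_m`. -/
def toTensor (m : Fin n → ℕ) : (words m →₀ K) →ₗ[K] TensorPower K (size m) V :=
  Finsupp.linearCombination K fun w => wordTensor x (wordFn w)

theorem toTensor_single (w : words m) (c : K) :
    toTensor x m (Finsupp.single w c) = c • wordTensor x (wordFn w) := by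
  rw [toTensor, Finsupp.linearCombination_single]

theorem toTensor_injective (m : Fin n → ℕ) : Function.Injective (toTensor x m) := by
  have hinj : Function.Injective (wordFn (m := m)) := fun w w' h =>
    Subtype.ext (by rw [← ofFn_wordFn w, h, ofFn_wordFn])
  have hbasis : ⇑(Basis.piTensorProduct fun _ : Fin (size m) => x) = wordTensor x :=
    funext fun f => Basis.piTensorProduct_apply _ f
  have hlin := (Basis.piTensorProduct fun _ : Fin (size m) => x).linearIndependent.comp _ hinj
  rwa [hbasis] at hlin

theorem range_toTensor (m : Fin n → ℕ) : LinearMap.range (toTensor x m) = component x m := by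
  rw [toTensor, Finsupp.range_linearCombination, component]
  congr 1
  ext y
  constructor
  · rintro ⟨w, rfl⟩
    exact ⟨wordFn w, by rw [ofFn_wordFn]; exact mem_words.1 w.2, rfl⟩
  · rintro ⟨g, hg, rfl⟩
    exact ⟨⟨List.ofFn g, mem_words.2 hg⟩, congrArg (wordTensor x) (wordFn_eq rfl)⟩

theorem ρ_S_comp_toTensor (hm : 0 < size m) :
    ρ x q (size m) (S K (size m) (size m - 1)) ∘ₗ toTensor x m =
      toTensor x m ∘ₗ shuffleOp q m := by
  refine Finsupp.lhom_ext fun w c => ?_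
  rw [LinearMap.comp_apply, LinearMap.comp_apply, toTensor_single, S, shuffleOp,
    Nat.sub_add_cancel hm, map_sum, LinearMap.sum_apply, LinearMap.sum_apply, map_sum]
  refine Finset.sum_congr rfl fun t ht => ?_
  obtain ⟨g, hg, hρ⟩ := ρ_descProd_wordTensor x q (wordFn w) (Finset.mem_range.1 ht)
  rw [ofFn_wordFn] at hg hρ
  rw [map_smul, hρ, moveOp, monomialOp_single, toTensor_single, smul_smul, mul_comm,
    wordFn_eq (w := moveWord m t w) hg]

theorem map_subtype_ker_domRestrict (hm : 0 < size m) :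
    (LinearMap.ker ((ρ x q (size m) (S K (size m) (size m - 1))).domRestrict
      (component x m))).map (component x m).subtype =
      (LinearMap.ker (shuffleOp q m)).map (toTensor x m) := by
  rw [LinearMap.ker_domRestrict, Submodule.map_comap_subtype, ← range_toTensor,
    ← Submodule.map_comap_eq, ← LinearMap.ker_comp, ρ_S_comp_toTensor x q hm,
    LinearMap.ker_comp_of_ker_eq_bot _ (LinearMap.ker_eq_bot.2 (toTensor_injective x m))]

theorem finrank_ker_domRestrict (hm : 0 < size m) :
    Module.finrank K (LinearMap.ker ((ρ x q (size m) (S K (size m) (size m - 1))).domRestrict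
      (component x m))) = Module.finrank K (LinearMap.ker (shuffleOp q m)) := by
  rw [← Submodule.finrank_map_subtype_eq, map_subtype_ker_domRestrict x q hm]
  exact (Submodule.equivMapOfInjective _ (toTensor_injective x m) _).finrank_eq.symm

end Tensor

end ShuffleKernel

end

theorem theorem6p2_general {K : Type*} [Field K] {V : Type*} [AddCommGroup V] [Module K V]
    {n : ℕ} (x : Module.Basis (Fin n) K V) (q : Fin n → Fin n → K)
    (m : Fin n → ℕ) (hm : 2 ≤ ShuffleKernel.size m)
    (hK : ((ShuffleKernel.size m).factorial : K) ≠ 0)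
    (hP : ShuffleKernel.evalAt q (ShuffleKernel.P m) = 0)
    (hl : ∀ l : Fin n → ℕ, l < m → 2 ≤ ShuffleKernel.size l →
      ShuffleKernel.evalAt q (ShuffleKernel.P l) ≠ 0) :
    (Module.finrank K (LinearMap.ker
        ((ShuffleKernel.ρ x q (ShuffleKernel.size m)
          (ShuffleKernel.S K (ShuffleKernel.size m) (ShuffleKernel.size m - 1))).domRestrict
            (ShuffleKernel.component x m))) : ℤ) =
      (ShuffleKernel.n₁ q m : ℤ) - (ShuffleKernel.n₂ q m : ℤ) := by
  have h := ShuffleKernel.finrank_ker_shuffleOp_of_minimal hm hK hP hl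
  rw [ShuffleKernel.finrank_ker_domRestrict x q (by omega)]
  omega

theorem theorem6p2 {K : Type*} [Field K] [CharZero K] {V : Type*} [AddCommGroup V] [Module K V]
    {n : ℕ} (x : Module.Basis (Fin n) K V) (q : Fin n → Fin n → K) (hq : ∀ i j, q i j ≠ 0)
    (m : Fin n → ℕ) (hm : 2 ≤ ShuffleKernel.size m)
    (hP : ShuffleKernel.evalAt q (ShuffleKernel.P m) = 0)
    (hl : ∀ l : Fin n → ℕ, l < m → 2 ≤ ShuffleKernel.size l →
      ShuffleKernel.evalAt q (ShuffleKernel.P l) ≠ 0) :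
    (Module.finrank K (LinearMap.ker
        ((ShuffleKernel.ρ x q (ShuffleKernel.size m)
          (ShuffleKernel.S K (ShuffleKernel.size m) (ShuffleKernel.size m - 1))).domRestrict
            (ShuffleKernel.component x m))) : ℤ) =
      (ShuffleKernel.n₁ q m : ℤ) - (ShuffleKernel.n₂ q m : ℤ) := by
  exact theorem6p2_general x q m hm (Nat.cast_ne_zero.2 (Nat.factorial_ne_zero _)) hP hl
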